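/- **Theorem (large deviation principle for the particle-mean-field model).** *Setting.* Let $d\ge 1$, $\beta>0$, $a>0$, $\alpha\le 0$, $\mu\in\mathbb R$, $\mathrm{bc}\in\{\emptyset,\mathrm{per},\mathrm{Dir}\}$, and let $\Lambda_N=[-N,N]^d$, $|\Lambda_N|=(2N)^d$, for $N\ge1$. Let $g_t(v)=(4\pi t)^{-d/2}e^{-|v|^2/(4t)}$ and, for $k\in\mathbb N=\{1,2,\dots\}$, $$q_k^{(\alpha)}=\frac{e^{\beta\alpha k}}{(4\pi\beta)^{d/2}k^{1+d/2}} .$$ Put $q_k^{(\emptyset,\alpha)}=q_k^{(\alpha)}$, and for $\mathrm{bc}\in\{\mathrm{per},\mathrm{Dir}\}$ put $$q_k^{(\mathrm{bc},\alpha)}=\frac{e^{\beta\alpha k}}{k|\Lambda_N|}\int_{\Lambda_N}g^{\mathrm{bc}}_{k\beta}(x,x)\,dx\quad (k\le N),\qquad q_k^{(\mathrm{bc},\alpha)}=0\quad(k>N),$$ where $g^{\mathrm{per}}_t(x,x)=\sum_{z\in\mathbb Z^d}g_t(2Nz)$, and $g^{\mathrm{Dir}}_t(x,x)=g_t(0)$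 times the probability that the Brownian bridge of generator $\Delta$ and time horizon $[0,t]$ from $x$ to $x$ stays in $\Lambda_N$. Let $\mathcal N_k$, $k\in\mathbb N$, be independent Poisson variables with means $|\Lambda_N|q_k^{(\mathrm{bc},\alpha)}$ (the numbers of points in $\Lambda_N$ with a mark of length $k$ in the marked Poisson process of Brownian cycles), and let $\nu^{\mathrm{bc}}_{N,\alpha}$ be the law of the empirical cycle count $(\mathcal N_k/|\Lambda_N|)_{k\in\mathbb N}$ on $\ell_1(\mathbb R)$. Let $\ell_1(\mathbb R_+)$ be the set of nonnegative sequences in $\ell_1(\mathbb R)$. For $x\in\ell_1(\mathbb R_+)$ let $D(x)=\sum_{k}k x_k\in[0,\infty]$ and $$H_\mu(x)=-\mu D(x)+\tfrac a2D(x)^2\quad(=+\infty\text{ if }D(x)=\infty),$$ and let $H_\mu=+\infty$ on $\ell_1(\mathbb R)\setminus\ell_1(\mathbb R_+)$. Let $H_{\mu,\mathrm{l.s.c.}}$ be the lower semicontinuous regularisation of $H_\mu$, i.e. the greatest lower semicontinuous function below $H_\mu$. Let $$\nu^{\mathrm{PMF}}_{N,\mu,\alpha}(dx)=\frac{e^{-|\Lambda_N|\beta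 H_\mu(x)}}{Z_N}\,\nu^{\mathrm{bc}}_{N,\alpha}(dx),\qquad Z_N=\int e^{-|\Lambda_N|\beta H_\mu}\,d\nu^{\mathrm{bc}}_{N,\alpha},$$ and, with $q_k=q_k^{(0)}$ and $0\log 0=0$, $$I(x)=\sum_{k}\Big(x_k\log\frac{x_k}{q_k}-x_k+q_k\Big)\in[0,\infty]\ \text{ for }x\in\ell_1(\mathbb R_+),\qquad I(x)=+\infty\ \text{ otherwise.}$$ *Claim.* The $\nu^{\mathrm{PMF}}_{N,\mu,\alpha}$, $N\ge 1$, are well-defined probability measures, and they satisfy a large deviation principle on $\ell_1(\mathbb R)$ (with its norm topology) with rate $|\Lambda_N|$ and rate function $$I^{\mathrm{PMF}}_{\mu,\alpha}(x)=\beta H_{\mu+\alpha,\mathrm{l.s.c.}}(x)+I(x)-\inf_{y\in\ell_1(\mathbb R)}\{\beta H_{\mu+\alpha,\mathrm{l.s.c.}}(y)+I(y)\},$$ that is, $I^{\mathrm{PMF}}_{\mu,\alpha}:\ell_1(\mathbb R)\to[0,\infty]$ is lower semicontinuous, and $$\limsup_{N\to\infty}\frac1{|\Lambda_N|}\log\nu^{\mathrm{PMF}}_{N,\mu,\alpha}(F)\le-\inf_FI^{\mathrm{PMF}}_{\mu,\alpha},\qquad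 \liminf_{N\to\infty}\frac1{|\Lambda_N|}\log\nu^{\mathrm{PMF}}_{N,\mu,\alpha}(G)\ge-\inf_GI^{\mathrm{PMF}}_{\mu,\alpha}$$ for all closed $F$ and all open $G$. Moreover, for every $m\in\mathbb R$ and $x\in\ell_1(\mathbb R_+)$, $$H_{m,\mathrm{l.s.c.}}(x)=H_m(x)-\frac1{2a}\big(m-aD(x)\big)_+^2=\begin{cases}-mD(x)+\frac a2D(x)^2, & D(x)\ge\frac ma,\\[2pt] -\frac{m^2}{2a}, & D(x)<\frac ma,\end{cases}$$ where the first case is read as $+\infty$ when $D(x)=\infty$. -/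

import Mathlib

open MeasureTheory ProbabilityTheory Filter Topology
open scoped NNReal ENNReal

/-! ### The sequence space and large deviation principles -/

/-- The Banach space `ℓ₁(ℝ)` of absolutely summable real sequences `(x_k)`, `k = 1, 2, 3, …`. -/
abbrev EllOne : Type := lp (fun _ : ℕ+ => ℝ) 1

/-- `ℓ₁(ℝ)` carries the Borel σ-algebra of its norm. -/
noncomputable instance EllOne.instMeasurableSpace : MeasurableSpace EllOne := borel EllOne

instance EllOne.instBorelSpace : BorelSpace EllOne := ⟨rfl⟩

/-- The cone `ℓ₁(ℝ₊)` of nonnegative summable sequences. -/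
def ellOneNonneg : Set EllOne := {x | ∀ k, 0 ≤ x k}

/-- The sequence of measures `ν N` satisfies a large deviation principle with rate (speed) `a N`
and rate function `I`. -/
structure SatisfiesLDP {X : Type*} [TopologicalSpace X] [MeasurableSpace X]
    (ν : ℕ → Measure X) (a : ℕ → ℝ) (I : X → EReal) : Prop where
  nonneg : ∀ x, 0 ≤ I x
  lowerSemicontinuous : LowerSemicontinuous I
  upper_bound : ∀ F : Set X, IsClosed F →
    limsup (fun N => (((a N)⁻¹ : ℝ) : EReal) * ENNReal.log (ν N F)) atTop ≤ -⨅ x ∈ F, I x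
  lower_bound : ∀ G : Set X, IsOpen G →
    -⨅ x ∈ G, I x ≤ liminf (fun N => (((a N)⁻¹ : ℝ) : EReal) * ENNReal.log (ν N G)) atTop

/-- The lower semicontinuous regularisation of `f`: the greatest lower semicontinuous function
below `f`. -/
noncomputable def lscRegularisation {X : Type*} [TopologicalSpace X] (f : X → EReal) :
    X → EReal :=
  fun x => ⨆ (g : X → EReal) (_ : LowerSemicontinuous g ∧ ∀ y, g y ≤ f y), g x

/-! ### Boxes, heat kernel, Brownian bridges -/

/-- Empty, periodic and Dirichlet boundary conditions. -/
inductive BoundaryCondition : Type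
  | empty
  | per
  | dir

/-- The box `Λ_N = [-N, N]^d`. -/
def box (d N : ℕ) : Set (EuclideanSpace ℝ (Fin d)) := {x | ∀ i, |x i| ≤ N}

/-- The volume `|Λ_N| = (2N)^d`. -/
def boxVolume (d N : ℕ) : ℝ := (2 * (N : ℝ)) ^ d

/-- The Gaussian kernel `g_t(0,v) = (4πt)^{-d/2} exp(-|v|²/(4t))` of the Brownian motion in `ℝ^d`
with generator `Δ`. -/
noncomputable def heatKernel (d : ℕ) (t : ℝ) (v : EuclideanSpace ℝ (Fin d)) : ℝ :=
  (4 * Real.pi * t) ^ (-(d : ℝ) / 2) * Real.exp (-‖v‖ ^ 2 / (4 * t))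

/-- The Schauder tent function on `[j 2⁻ⁿ, (j+1) 2⁻ⁿ]`, i.e. the primitive of the normalised Haar
function on that dyadic interval. -/
noncomputable def schauder (n j : ℕ) (u : ℝ) : ℝ :=
  (2 : ℝ) ^ (-(n : ℝ) / 2) * max 0 (1 / 2 - |2 ^ n * u - j - 1 / 2|)

/-- Lévy's construction of the standard Brownian bridge on `[0,1]` (the centred continuous Gaussian
process with covariance `min u v - u v`): if the `z (n, j)` are i.i.d. standard normal variables
then this series converges uniformly on `[0,1]`, almost surely, to a standard Brownian bridge. -/
noncomputable def standardBridge (z : ℕ × ℕ → ℝ) (u : ℝ) : ℝ :=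
  ∑' n : ℕ, ∑ j ∈ Finset.range (2 ^ n), z (n, j) * schauder n j u

/-- The Brownian bridge in `ℝ^d` for the generator `Δ`, with time horizon `[0,T]`, starting and
ending at `x`, as a function of i.i.d. standard normal variables `z`: its coordinates are
independent, with variance `2 s (T - s) / T` at time `s`. -/
noncomputable def brownianBridge (d : ℕ) (T : ℝ) (x : EuclideanSpace ℝ (Fin d))
    (z : Fin d × ℕ × ℕ → ℝ) (s : ℝ) : EuclideanSpace ℝ (Fin d) :=
  WithLp.toLp 2 fun i => x i + √(2 * T) * standardBridge (fun p => z (i, p)) (s / T)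

/-- The law of a family of i.i.d. standard normal variables. -/
noncomputable def gaussianNoise (d : ℕ) : Measure (Fin d × ℕ × ℕ → ℝ) :=
  Measure.infinitePi fun _ => gaussianReal 0 1

/-- The total mass `g_t^{bc}(x,x)` of the measure of Brownian loops of time horizon `[0,t]` rooted
at `x ∈ Λ_N`: for the empty boundary condition all loops in `ℝ^d`; for the periodic one loops on
the torus of side length `2N`; for the Dirichlet one the loops that stay in `Λ_N`. -/
noncomputable def loopMass (d N : ℕ) (bc : BoundaryCondition) (t : ℝ)
    (x : EuclideanSpace ℝ (Fin d)) : ℝ≥0∞ :=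
  match bc with
  | .empty => ENNReal.ofReal (heatKernel d t 0)
  | .per => ∑' z : Fin d → ℤ,
      ENNReal.ofReal (heatKernel d t (WithLp.toLp 2 fun i => 2 * (N : ℝ) * (z i : ℝ)))
  | .dir => ENNReal.ofReal (heatKernel d t 0) *
      gaussianNoise d {z | ∀ s ∈ Set.Icc (0 : ℝ) t, brownianBridge d t x z s ∈ box d N}

/-! ### The ideal Bose gas -/

/-- The cycle weight `q_k^{(α)} = e^{βαk} / ((4πβ)^{d/2} k^{1+d/2})`. -/
noncomputable def cycleWeight (d : ℕ) (β α : ℝ) (k : ℕ+) : ℝ :=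
  Real.exp (β * α * (k : ℝ)) /
    ((4 * Real.pi * β) ^ ((d : ℝ) / 2) * (k : ℝ) ^ (1 + (d : ℝ) / 2))

/-- The finite-volume cycle weight `q_k^{(bc,α)}`: for the empty boundary condition this is
`q_k^{(α)}`; for the periodic and the Dirichlet boundary conditions it is
`e^{βαk} (k |Λ_N|)⁻¹ ∫_{Λ_N} g_{kβ}^{bc}(x,x) dx` for `k ≤ N`, and the process has no cycles of
length `k > N`. -/
noncomputable def bcCycleWeight (d N : ℕ) (bc : BoundaryCondition) (β α : ℝ) (k : ℕ+) : ℝ :=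
  match bc with
  | .empty => cycleWeight d β α k
  | .per => if (k : ℕ) ≤ N then Real.exp (β * α * (k : ℝ)) / ((k : ℝ) * boxVolume d N) *
      (∫⁻ x in box d N, loopMass d N .per ((k : ℝ) * β) x).toReal else 0
  | .dir => if (k : ℕ) ≤ N then Real.exp (β * α * (k : ℝ)) / ((k : ℝ) * boxVolume d N) *
      (∫⁻ x in box d N, loopMass d N .dir ((k : ℝ) * β) x).toReal else 0

/-- The joint law of the numbers `𝒩_k`, `k ≥ 1`, of points in `Λ_N` with mark of length `k` of the
marked Poisson point process: the numbers of points of a Poisson process in disjoint sets are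
independent and Poisson distributed, with the intensity measure `|Λ_N| q_k^{(bc,α)}` of the set as
parameter. -/
noncomputable def cycleNumberLaw (d N : ℕ) (bc : BoundaryCondition) (β α : ℝ) :
    Measure (ℕ+ → ℕ) :=
  Measure.infinitePi fun k =>
    poissonMeasure (Real.toNNReal (boxVolume d N * bcCycleWeight d N bc β α k))

open Classical in
/-- The empirical cycle count `λ_N = (𝒩_k / |Λ_N|)_k` as an element of `ℓ₁`. (The other branch is
taken with probability zero.) -/
noncomputable def empiricalCycleCount (d N : ℕ) (n : ℕ+ → ℕ) : EllOne :=
  if h : Memℓp (fun k : ℕ+ => (n k : ℝ) / boxVolume d N) 1 then ⟨_, h⟩ else 0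

/-- The law `ν_{N,α}^{bc}` of the empirical cycle count on `ℓ₁(ℝ)`. -/
noncomputable def idealMeasure (d : ℕ) (bc : BoundaryCondition) (β α : ℝ) (N : ℕ) :
    Measure EllOne :=
  (cycleNumberLaw d N bc β α).map (empiricalCycleCount d N)

open Classical in
/-- The rate function of the ideal Bose gas, `I_α(x) = ∑_k x_k (log (x_k / q_k) - 1) + ∑_k q_k`
with `q_k = q_k^{(α)}` and `0 log 0 = 0`, on nonnegative sequences, and `+∞` otherwise. It is
written as the series of the nonnegative terms `x_k log (x_k / q_k) - x_k + q_k`. -/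
noncomputable def idealRate (d : ℕ) (β α : ℝ) (x : EllOne) : EReal :=
  if x ∈ ellOneNonneg then
    ((∑' k : ℕ+, ENNReal.ofReal (x k * Real.log (x k / cycleWeight d β α k) - x k
      + cycleWeight d β α k) : ℝ≥0∞) : EReal)
  else ⊤

/-! ### The particle-mean-field model -/

/-- The density `D(x) = ∑_k k x_k ∈ [0,∞]` of a nonnegative sequence. -/
noncomputable def density (x : EllOne) : ℝ≥0∞ := ∑' k : ℕ+, ENNReal.ofReal ((k : ℝ) * x k)

/-- The energy `-μ D + (a/2) D²` at density `D ∈ [0,∞]`, equal to `+∞` at `D = ∞`. -/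
noncomputable def meanFieldEnergy (a μ : ℝ) (D : ℝ≥0∞) : EReal :=
  if D = ∞ then ⊤ else ((-μ * D.toReal + a / 2 * D.toReal ^ 2 : ℝ) : EReal)

open Classical in
/-- The Hamiltonian `H_μ(x) = -μ D(x) + (a/2) D(x)²` on `ℓ₁(ℝ₊)`, set to `+∞` on the rest of
`ℓ₁(ℝ)`. -/
noncomputable def pmfHamiltonian (a μ : ℝ) (x : EllOne) : EReal :=
  if x ∈ ellOneNonneg then meanFieldEnergy a μ (density x) else ⊤

/-- The Boltzmann factor `exp(-|Λ_N| β H_μ(x))`. -/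
noncomputable def pmfBoltzmann (d : ℕ) (β a μ : ℝ) (N : ℕ) (x : EllOne) : ℝ≥0∞ :=
  EReal.exp (((-(boxVolume d N * β) : ℝ) : EReal) * pmfHamiltonian a μ x)

/-- The partition function `Z_N(β,μ,α)`. -/
noncomputable def pmfPartition (d : ℕ) (bc : BoundaryCondition) (β a μ α : ℝ) (N : ℕ) : ℝ≥0∞ :=
  ∫⁻ x, pmfBoltzmann d β a μ N x ∂(idealMeasure d bc β α N)

/-- The tilted measure `ν_{N,μ,α}^{PMF}`. -/
noncomputable def pmfMeasure (d : ℕ) (bc : BoundaryCondition) (β a μ α : ℝ) (N : ℕ) :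
    Measure EllOne :=
  (idealMeasure d bc β α N).withDensity
    fun x => pmfBoltzmann d β a μ N x / pmfPartition d bc β a μ α N

/-- The lower semicontinuous regularisation `H_{μ,l.s.c.}` of the Hamiltonian. -/
noncomputable def pmfHamiltonianLsc (a μ : ℝ) : EllOne → EReal :=
  lscRegularisation (pmfHamiltonian a μ)

/-- The rate function
`β H_{μ+α,l.s.c.}(x) + I_0(x) - inf_y {β H_{μ+α,l.s.c.}(y) + I_0(y)}`. -/
noncomputable def pmfRate (d : ℕ) (β a μ α : ℝ) (x : EllOne) : EReal :=
  ((β : EReal) * pmfHamiltonianLsc a (μ + α) x + idealRate d β 0 x)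
    - ⨅ y : EllOne, ((β : EReal) * pmfHamiltonianLsc a (μ + α) y + idealRate d β 0 y)

/-!
The measures are studied through the unnormalised ones `e^{-|Λ_N| β H_μ} dν_{N,α}`
(`pmfUnnormalised`); the rate of the partition function is the case of the whole space, and dividing
by it subtracts the infimum of `pmfFunctional`.

Three observations carry the proof.

*The parameters `μ` and `α` enter through `μ + α` only.* The cycle weights satisfy
`q_k^{(bc,α)} = e^{βαk} q_k^{(bc,0)}`, so passing from `α` to `0` multiplies the Poisson law by
`e^{-|Λ_N| βα D}` up to the constant `e^{|Λ_N| massShift}`, and `H_μ - α D = H_{μ+α}`. The constant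
is common to all events and cancels in the normalisation. The boundary condition matters only
through `q_k^{(bc,0)} ≤ C q_k` and `q_k^{(bc,0)} → q_k` (`exists_bcCycleWeight_le`,
`tendsto_bcCycleWeight`): for the periodic one a theta function tends to `1` uniformly in `k ≤ N`,
for the Dirichlet one a bridge started far from the boundary stays in the box with probability
close to one, as Lévy's series is bounded almost surely.

*The regularised Hamiltonian is explicit* (`pmfHamiltonianLsc_eq`). The density is only lower
semicontinuous: moving the density `ρ` into cycles of length `n` changes `x` by `ρ / n` in `ℓ₁`.
Hence density can be added for free in the limit, and the energy is replaced by its largest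
nondecreasing minorant. The same long cycles have vanishing entropic cost
(`tendsto_long_cycle_cost`), which is why the regularisation is also attained in the lower bound.

*Both bounds are elementary for Poisson variables.* For the upper bound, near a point `x` the
Hamiltonian exceeds a constant close to `H_{μ+α,l.s.c.}(x)`, and the exponential Chebyshev
inequality (`pmfUnnormalised_le`) with finitely many exponents reproduces the entropy; closed sets
are reduced to compact ones by exponential tightness
(`exists_isCompact_pmfUnnormalised_compl_le`), where compactness in `ℓ₁` amounts to uniformly small
tails. For the lower bound, every point is approximated by finitely supported sequences `y` at
nearly the same rate (`exists_finite_support_of_pmfFunctional_lt`), and the probability of the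
single configuration `⌊|Λ_N| y_k⌋` suffices, by Stirling's formula
(`eventually_le_pmfUnnormalised`).
-/

/-! ### Products of Poisson distributions -/

lemma poissonMeasure_ne_zero_le (r : ℝ≥0) : poissonMeasure r {n | n ≠ 0} ≤ r := by
  have h : ({n | n ≠ 0} : Set ℕ) = {0}ᶜ := rfl
  rw [h, prob_compl_eq_one_sub (measurableSet_singleton 0), poissonMeasure_singleton,
    tsub_le_iff_right, ← ENNReal.ofReal_coe_nnreal,
    ← ENNReal.ofReal_add r.coe_nonneg (by positivity), ENNReal.one_le_ofReal]
  have := Real.add_one_le_exp (-(r : ℝ))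
  simp only [pow_zero, mul_one, Nat.factorial_zero, Nat.cast_one, div_one]
  linarith

lemma lintegral_exp_poissonMeasure (r : ℝ≥0) (s : ℝ) :
    ∫⁻ n, ENNReal.ofReal (Real.exp (s * n)) ∂(poissonMeasure r)
      = ENNReal.ofReal (Real.exp (r * (Real.exp s - 1))) := by
  rw [poissonMeasure, lintegral_sum_measure]
  simp only [lintegral_smul_measure, lintegral_dirac, smul_eq_mul]
  have h1 : ∀ n : ℕ, ENNReal.ofReal (Real.exp (-r) * r ^ n / n.factorial)
      * ENNReal.ofReal (Real.exp (s * n))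
      = ENNReal.ofReal (Real.exp (-r) * ((r * Real.exp s) ^ n / n.factorial)) := by
    intro n
    rw [← ENNReal.ofReal_mul (by positivity)]
    congr 1
    rw [mul_pow, ← Real.exp_nat_mul, mul_comm s]
    ring
  have h2 := (NormedSpace.expSeries_div_hasSum_exp ((r : ℝ) * Real.exp s)).mul_left
    (Real.exp (-r))
  rw [← Real.exp_eq_exp_ℝ, ← Real.exp_add] at h2
  simp_rw [h1]
  rw [← ENNReal.ofReal_tsum_of_nonneg (fun n => by positivity) h2.summable, h2.tsum_eq]
  congr 2
  ring

lemma lintegral_exp_sum_infinitePi_poissonMeasure {ι : Type*} {r : ι → ℝ≥0}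
    (S : Finset ι) (s : ι → ℝ) :
    ∫⁻ n, ENNReal.ofReal (Real.exp (∑ k ∈ S, s k * n k))
      ∂(Measure.infinitePi fun k => poissonMeasure (r k))
      = ENNReal.ofReal (Real.exp (∑ k ∈ S, r k * (Real.exp (s k) - 1))) := by
  have h := lintegral_prod_eq_prod_lintegral_of_indepFun
    (μ := Measure.infinitePi fun k => poissonMeasure (r k)) S
    (fun k n => ENNReal.ofReal (Real.exp (s k * n k)))
    (iIndepFun_infinitePi (X := fun k (m : ℕ) => ENNReal.ofReal (Real.exp (s k * m)))
      fun _ => .of_discrete) (fun k => by fun_prop)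
  simp_rw [Real.exp_sum, ENNReal.ofReal_prod_of_nonneg fun _ _ => (Real.exp_pos _).le]
  rw [h]
  refine Finset.prod_congr rfl fun k _ => ?_
  rw [← lintegral_exp_poissonMeasure, ← Measure.infinitePi_map_eval
    (fun k => poissonMeasure (r k)) k, lintegral_map .of_discrete (measurable_pi_apply k)]

section PoissonProduct

variable {ι : Type*} [Countable ι] {r : ι → ℝ≥0}

/-- By the Borel–Cantelli lemma, only finitely many of independent Poisson variables with summable
parameters are nonzero. -/
lemma ae_finite_support_infinitePi_poissonMeasure (hr : Summable r) :
    ∀ᵐ n ∂(Measure.infinitePi fun k => poissonMeasure (r k)), (Function.support n).Finite := by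
  refine ae_finite_setOfPred_mem (s := fun k => {n : ι → ℕ | n k ≠ 0}) ?_
  have h : ∀ k, (Measure.infinitePi fun k => poissonMeasure (r k)) {n : ι → ℕ | n k ≠ 0}
      ≤ r k := by
    intro k
    rw [← Set.preimage_ofPred_eq (p := fun m : ℕ => m ≠ 0) (f := fun n : ι → ℕ => n k),
      ← Measure.map_apply (measurable_pi_apply k) (.of_discrete),
      Measure.infinitePi_map_eval]
    exact poissonMeasure_ne_zero_le (r k)
  exact ne_top_of_le_ne_top (ENNReal.tsum_coe_ne_top_iff_summable.2 hr) (ENNReal.tsum_le_tsum h)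

/-- The exponential moments of independent Poisson variables; by Fatou's lemma, passing from
finitely many to countably many variables can only lose mass. -/
lemma lintegral_exp_tsum_infinitePi_poissonMeasure_le (hr : Summable r) (s : ι → ℝ)
    (hs : Summable fun k => r k * Real.exp (s k)) :
    ∫⁻ n, ENNReal.ofReal (Real.exp (∑' k, s k * n k))
      ∂(Measure.infinitePi fun k => poissonMeasure (r k))
      ≤ ENNReal.ofReal (Real.exp (∑' k, r k * (Real.exp (s k) - 1))) := by
  have hsum : Summable fun k => (r k : ℝ) * (Real.exp (s k) - 1) := by
    simpa [mul_sub] using hs.sub (NNReal.summable_coe.2 hr)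
  have hF : ∀ᵐ n ∂(Measure.infinitePi fun k => poissonMeasure (r k)),
      ENNReal.ofReal (Real.exp (∑' k, s k * n k))
        = liminf (fun S : Finset ι => ENNReal.ofReal (Real.exp (∑ k ∈ S, s k * n k))) atTop := by
    filter_upwards [ae_finite_support_infinitePi_poissonMeasure hr] with n hn
    have : Summable fun k => s k * (n k : ℝ) := by
      refine summable_of_hasFiniteSupport (hn.subset ?_)
      intro k hk
      simp only [Function.mem_support, ne_eq, mul_eq_zero, not_or, Nat.cast_eq_zero] at hk ⊢
      exact hk.2
    refine (Tendsto.liminf_eq ?_).symm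
    exact (ENNReal.continuous_ofReal.comp Real.continuous_exp).continuousAt.tendsto.comp
      this.hasSum
  rw [lintegral_congr_ae hF]
  refine (lintegral_liminf_le' ?_).trans ?_
  · intro S
    have : Measurable fun n : ι → ℕ => ∑ k ∈ S, s k * (n k : ℝ) :=
      Finset.measurable_sum _ fun k _ =>
        (Measurable.of_discrete.comp (measurable_pi_apply k)).const_mul _
    exact (Real.measurable_exp.comp this).ennreal_ofReal.aemeasurable
  · simp_rw [lintegral_exp_sum_infinitePi_poissonMeasure]
    refine (Tendsto.liminf_eq ?_).le
    exact (ENNReal.continuous_ofReal.comp Real.continuous_exp).continuousAt.tendsto.comp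
      hsum.hasSum

lemma infinitePi_poissonMeasure_singleton_ge (hr : Summable r) (n : ι → ℕ) (S : Finset ι)
    (hn : ∀ k ∉ S, n k = 0) :
    ENNReal.ofReal (Real.exp (-∑' k, (r k : ℝ)) * ∏ k ∈ S, (r k : ℝ) ^ n k / (n k).factorial)
      ≤ (Measure.infinitePi fun k => poissonMeasure (r k)) {n} := by
  classical
  rw [Measure.infinitePi_singleton, ENNReal.tprod_eq_iInf_prod (fun _ => prob_le_one)]
  refine le_iInf fun T => ?_
  have hle : ∏ k ∈ T ∪ S, poissonMeasure (r k) {n k} ≤ ∏ k ∈ T, poissonMeasure (r k) {n k} :=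
    Finset.prod_le_prod_of_subset_of_le_one' Finset.subset_union_left
      fun _ _ _ => prob_le_one
  refine le_trans ?_ hle
  simp_rw [poissonMeasure_singleton, mul_div_assoc]
  rw [← ENNReal.ofReal_prod_of_nonneg fun _ _ => by positivity, Finset.prod_mul_distrib,
    ← Real.exp_sum]
  refine ENNReal.ofReal_le_ofReal ?_
  have h1 : ∏ k ∈ T ∪ S, (r k : ℝ) ^ n k / (n k).factorial
      = ∏ k ∈ S, (r k : ℝ) ^ n k / (n k).factorial := by
    refine (Finset.prod_subset Finset.subset_union_right fun k _ hk => ?_).symm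
    simp [hn k hk]
  rw [h1]
  refine mul_le_mul_of_nonneg_right ?_ (Finset.prod_nonneg fun _ _ => by positivity)
  rw [Finset.sum_neg_distrib]
  exact Real.exp_le_exp.2 (neg_le_neg
    ((NNReal.summable_coe.2 hr).sum_le_tsum _ fun _ _ => NNReal.coe_nonneg _))

end PoissonProduct

/-! ### Boxes and cycle weights -/

lemma box_eq_preimage (d N : ℕ) :
    box d N = WithLp.ofLp ⁻¹' Set.Icc (fun _ : Fin d => -(N : ℝ)) (fun _ => (N : ℝ)) := by
  ext x
  simp only [box, abs_le, Set.mem_preimage, Set.mem_Icc, Pi.le_def]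
  exact forall_and

lemma measurableSet_box (d N : ℕ) : MeasurableSet (box d N) := by
  rw [box_eq_preimage]
  exact (PiLp.volume_preserving_ofLp (Fin d)).measurable measurableSet_Icc

lemma volume_box (d N : ℕ) : volume (box d N) = ENNReal.ofReal (boxVolume d N) := by
  rw [box_eq_preimage, (PiLp.volume_preserving_ofLp (Fin d)).measure_preimage
    measurableSet_Icc.nullMeasurableSet, Real.volume_Icc_pi]
  simp only [Finset.prod_const, Finset.card_univ, Fintype.card_fin, boxVolume]
  rw [← ENNReal.ofReal_pow (by linarith [N.cast_nonneg (α := ℝ)])]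
  congr 2
  ring

lemma boxVolume_nonneg (d N : ℕ) : 0 ≤ boxVolume d N := by
  unfold boxVolume
  positivity

lemma boxVolume_pos (d : ℕ) {N : ℕ} (hN : 1 ≤ N) : 0 < boxVolume d N := by
  have : 0 < (N : ℝ) := by exact_mod_cast hN
  unfold boxVolume
  positivity

lemma two_mul_le_boxVolume {d : ℕ} (hd : 1 ≤ d) {N : ℕ} (hN : 1 ≤ N) :
    2 * (N : ℝ) ≤ boxVolume d N := by
  have : 1 ≤ (N : ℝ) := by exact_mod_cast hN
  exact le_self_pow₀ (by linarith) (by omega)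

lemma tendsto_boxVolume {d : ℕ} (hd : 1 ≤ d) : Tendsto (boxVolume d) atTop atTop := by
  refine tendsto_atTop_mono' atTop ?_ tendsto_natCast_atTop_atTop
  filter_upwards [eventually_ge_atTop 1] with N hN
  have := two_mul_le_boxVolume hd hN
  linarith [N.cast_nonneg (α := ℝ)]

lemma cycleWeight_pos (d : ℕ) {β : ℝ} (hβ : 0 < β) (α : ℝ) (k : ℕ+) :
    0 < cycleWeight d β α k := by
  have : 0 < (k : ℝ) := by exact_mod_cast k.pos
  have := Real.pi_pos
  unfold cycleWeight
  positivity

lemma cycleWeight_eq_exp_mul (d : ℕ) (β α : ℝ) (k : ℕ+) :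
    cycleWeight d β α k = Real.exp (β * α * k) * cycleWeight d β 0 k := by
  simp [cycleWeight, div_eq_mul_inv]

lemma summable_cycleWeight_zero {d : ℕ} (hd : 1 ≤ d) (β : ℝ) :
    Summable fun k : ℕ+ => cycleWeight d β 0 k := by
  have hp : 1 < 1 + (d : ℝ) / 2 := by
    have : (1 : ℝ) ≤ d := by exact_mod_cast hd
    linarith
  have h := ((Real.summable_nat_rpow_inv.2 hp).comp_injective PNat.coe_injective).mul_left
    (((4 * Real.pi * β) ^ ((d : ℝ) / 2))⁻¹)
  refine h.congr fun k => ?_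
  simp [cycleWeight, mul_comm]

lemma heatKernel_zero_eq (d : ℕ) {β : ℝ} (hβ : 0 < β) (k : ℕ+) :
    heatKernel d (k * β) 0 = k * cycleWeight d β 0 k := by
  have hk : 0 < (k : ℝ) := by exact_mod_cast k.pos
  have hpi := Real.pi_pos
  have h1 : 4 * Real.pi * (k * β) = (4 * Real.pi * β) * k := by ring
  have h2 : -(d : ℝ) / 2 = -((d : ℝ) / 2) := by ring
  simp only [heatKernel, cycleWeight, norm_zero]
  rw [h1, h2, Real.mul_rpow (by positivity) hk.le, Real.rpow_neg (by positivity),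
    Real.rpow_neg hk.le, Real.rpow_add hk, Real.rpow_one]
  simp
  field_simp

lemma heatKernel_zero_pos (d : ℕ) {β : ℝ} (hβ : 0 < β) (k : ℕ+) :
    0 < heatKernel d (k * β) 0 := by
  rw [heatKernel_zero_eq d hβ]
  have : 0 < (k : ℝ) := by exact_mod_cast k.pos
  exact mul_pos this (cycleWeight_pos d hβ 0 k)

lemma bcCycleWeight_eq_exp_mul (d N : ℕ) (bc : BoundaryCondition) (β α : ℝ) (k : ℕ+) :
    bcCycleWeight d N bc β α k = Real.exp (β * α * k) * bcCycleWeight d N bc β 0 k := by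
  cases bc with
  | empty => exact cycleWeight_eq_exp_mul d β α k
  | per => simp only [bcCycleWeight]; split_ifs <;> simp; ring
  | dir => simp only [bcCycleWeight]; split_ifs <;> simp; ring

lemma bcCycleWeight_nonneg (d N : ℕ) (bc : BoundaryCondition) {β : ℝ} (hβ : 0 < β) (α : ℝ)
    (k : ℕ+) : 0 ≤ bcCycleWeight d N bc β α k := by
  have := boxVolume_nonneg d N
  cases bc with
  | empty => exact (cycleWeight_pos d hβ α k).le
  | per => simp only [bcCycleWeight]; split_ifs <;> positivity
  | dir => simp only [bcCycleWeight]; split_ifs <;> positivity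

/-! ### Periodic boundary condition -/

lemma tsum_pi_prod_eq_pow (f : ℤ → ℝ≥0∞) (d : ℕ) :
    ∑' z : Fin d → ℤ, ∏ i, f (z i) = (∑' j, f j) ^ d := by
  induction d with
  | zero => simp
  | succ d ih =>
    rw [← (Fin.consEquiv fun _ => ℤ).tsum_eq, ENNReal.tsum_prod']
    simp only [Fin.consEquiv_apply, Fin.prod_univ_succ, Fin.cons_zero, Fin.cons_succ]
    simp_rw [ENNReal.tsum_mul_left, ENNReal.tsum_mul_right, ih]
    ring

lemma summable_int_exp_neg_sq {c : ℝ} (hc : 0 < c) :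
    Summable fun z : ℤ => Real.exp (-(c * (z : ℝ) ^ 2)) := by
  have hg : Summable fun n : ℕ => Real.exp (-c) ^ n :=
    summable_geometric_of_lt_one (Real.exp_pos _).le (by simpa using hc)
  have key : ∀ n : ℕ, Real.exp (-(c * (n : ℝ) ^ 2)) ≤ Real.exp (-c) ^ n := by
    intro n
    rw [← Real.exp_nat_mul, Real.exp_le_exp]
    have : (n : ℝ) ≤ (n : ℝ) ^ 2 := by exact_mod_cast Nat.le_self_pow two_ne_zero n
    nlinarith
  refine Summable.of_nat_of_neg ?_ ?_ <;>
  · refine hg.of_nonneg_of_le (fun n => (Real.exp_pos _).le) fun n => ?_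
    simpa using key n

lemma tendsto_tsum_int_exp_neg_sq {c : ℝ} (hc : 0 < c) :
    Tendsto (fun N : ℕ => ∑' z : ℤ, Real.exp (-(N * c * (z : ℝ) ^ 2))) atTop (𝓝 1) := by
  have h1 : ∑' z : ℤ, (if z = 0 then (1 : ℝ) else 0) = 1 := tsum_ite_eq 0 (fun _ => (1 : ℝ))
  rw [← h1]
  refine tendsto_tsum_of_dominated_convergence (summable_int_exp_neg_sq hc) ?_ ?_
  · intro z
    split_ifs with hz
    · simp [hz]
    · have hz2 : 0 < c * (z : ℝ) ^ 2 := by positivity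
      have : Tendsto (fun N : ℕ => -((N : ℝ) * (c * (z : ℝ) ^ 2))) atTop atBot :=
        tendsto_neg_atTop_atBot.comp (tendsto_natCast_atTop_atTop.atTop_mul_const hz2)
      simpa [Function.comp_def, mul_assoc] using Real.tendsto_exp_atBot.comp this
  · filter_upwards [eventually_ge_atTop 1] with N hN z
    rw [Real.norm_eq_abs, Real.abs_exp, Real.exp_le_exp]
    have : (1 : ℝ) ≤ N := by exact_mod_cast hN
    have : 0 ≤ c * (z : ℝ) ^ 2 := by positivity
    nlinarith

lemma heatKernel_toLp (d : ℕ) (t : ℝ) (v : Fin d → ℝ) :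
    heatKernel d t (WithLp.toLp 2 v) = heatKernel d t 0 * ∏ i, Real.exp (-(v i ^ 2 / (4 * t))) := by
  rw [← Real.exp_sum]
  simp [heatKernel, EuclideanSpace.norm_sq_eq, Finset.sum_div, neg_div]

/-- The periodic loop mass factorises over the coordinates into one-dimensional theta
functions. -/
lemma loopMass_per_eq (d N : ℕ) {t : ℝ} (x : EuclideanSpace ℝ (Fin d)) :
    loopMass d N .per t x = ENNReal.ofReal (heatKernel d t 0) *
      (∑' j : ℤ, ENNReal.ofReal (Real.exp (-((2 * (N : ℝ) * (j : ℝ)) ^ 2 / (4 * t))))) ^ d := by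
  simp only [loopMass, heatKernel_toLp]
  rw [← tsum_pi_prod_eq_pow, ← ENNReal.tsum_mul_left]
  refine tsum_congr fun z => ?_
  rw [ENNReal.ofReal_mul' (Finset.prod_nonneg fun _ _ => (Real.exp_pos _).le),
    ENNReal.ofReal_prod_of_nonneg fun _ _ => (Real.exp_pos _).le]

lemma bcCycleWeight_per_bounds (d : ℕ) {N : ℕ} {β : ℝ} (hβ : 0 < β) (k : ℕ+)
    (hkN : (k : ℕ) ≤ N) :
    cycleWeight d β 0 k ≤ bcCycleWeight d N .per β 0 k ∧
    bcCycleWeight d N .per β 0 k ≤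
      (∑' z : ℤ, Real.exp (-(N * β⁻¹ * (z : ℝ) ^ 2))) ^ d * cycleWeight d β 0 k := by
  have hk : 0 < (k : ℝ) := by exact_mod_cast k.pos
  have hkN' : (k : ℝ) ≤ N := by exact_mod_cast hkN
  have hN : 0 < (N : ℝ) := hk.trans_le hkN'
  have hV : 0 < boxVolume d N := boxVolume_pos d (k.pos.trans_le hkN)
  have hq := cycleWeight_pos d hβ 0 k
  -- the summand at distance `2N|z|`, for a loop of length `k ≤ N`
  set f : ℤ → ℝ := fun z => Real.exp (-((2 * (N : ℝ) * (z : ℝ)) ^ 2 / (4 * (k * β)))) with hf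
  have hfle : ∀ z, f z ≤ Real.exp (-(N * β⁻¹ * (z : ℝ) ^ 2)) := by
    intro z
    rw [hf, Real.exp_le_exp, neg_le_neg_iff, le_div_iff₀ (by positivity)]
    have h1 : N * β⁻¹ * (z : ℝ) ^ 2 * (4 * (k * β)) = 4 * N * z ^ 2 * k := by
      field_simp
    rw [h1]
    nlinarith [mul_le_mul_of_nonneg_left hkN' (by positivity : 0 ≤ 4 * N * (z : ℝ) ^ 2)]
  have hsum := summable_int_exp_neg_sq (c := N * β⁻¹) (by positivity)
  have hfs : Summable f := hsum.of_nonneg_of_le (fun z => (Real.exp_pos _).le) hfle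
  have hone : 1 ≤ ∑' z, f z := by
    have := hfs.le_tsum 0 fun z _ => (Real.exp_pos _).le
    simpa [hf] using this
  have hT : ∑' j : ℤ, ENNReal.ofReal (Real.exp (-((2 * (N : ℝ) * (j : ℝ)) ^ 2 / (4 * (k * β)))))
      = ENNReal.ofReal (∑' z, f z) :=
    (ENNReal.ofReal_tsum_of_nonneg (fun z => (Real.exp_pos _).le) hfs).symm
  have hval : bcCycleWeight d N .per β 0 k = (∑' z, f z) ^ d * cycleWeight d β 0 k := by
    simp only [bcCycleWeight, if_pos hkN, loopMass_per_eq, lintegral_const,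
      Measure.restrict_apply_univ, volume_box, hT]
    clear_value f
    rw [← ENNReal.ofReal_pow (by positivity), ← ENNReal.ofReal_mul (heatKernel_zero_pos d hβ k).le,
      ← ENNReal.ofReal_mul (mul_nonneg (heatKernel_zero_pos d hβ k).le (by positivity)),
      ENNReal.toReal_ofReal (by have := heatKernel_zero_pos d hβ k; positivity),
      heatKernel_zero_eq d hβ]
    simp only [mul_zero, zero_mul, Real.exp_zero]
    field_simp
  rw [hval]
  constructor
  · exact le_mul_of_one_le_left hq.le (one_le_pow₀ hone)
  · exact mul_le_mul_of_nonneg_right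
      (pow_le_pow_left₀ (by linarith) (hfs.tsum_le_tsum hfle hsum) _) hq.le

/-! ### Dirichlet boundary condition -/

lemma schauder_nonneg (n j : ℕ) (u : ℝ) : 0 ≤ schauder n j u := by
  unfold schauder
  positivity

lemma schauder_le (n j : ℕ) (u : ℝ) : schauder n j u ≤ (2 : ℝ) ^ (-(n : ℝ) / 2) := by
  unfold schauder
  refine mul_le_of_le_one_right (by positivity) (max_le zero_le_one ?_)
  linarith [abs_nonneg (2 ^ n * u - j - 1 / 2)]

lemma schauder_eq_zero_of_ne {n i j : ℕ} {u : ℝ} (hi : schauder n i u ≠ 0) (hij : j ≠ i) :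
    schauder n j u = 0 := by
  by_contra hj
  have key : ∀ l : ℕ, schauder n l u ≠ 0 → (l : ℝ) < 2 ^ n * u ∧ 2 ^ n * u < l + 1 := by
    intro l hl
    have : |2 ^ n * u - l - 1 / 2| < 1 / 2 := by
      by_contra h
      refine hl ?_
      rw [schauder, max_eq_left (by linarith), mul_zero]
    rw [abs_lt] at this
    constructor <;> linarith
  obtain ⟨h1, h2⟩ := key i hi
  obtain ⟨h3, h4⟩ := key j hj
  have h5 : i < j + 1 := by exact_mod_cast h1.trans h4
  have h6 : j < i + 1 := by exact_mod_cast h3.trans h2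
  omega

lemma abs_sum_mul_schauder_le (n : ℕ) (u : ℝ) {z : ℕ → ℝ} {M : ℝ} (S : Finset ℕ)
    (hM : 0 ≤ M) (hz : ∀ j ∈ S, |z j| ≤ M) :
    |∑ j ∈ S, z j * schauder n j u| ≤ M * (2 : ℝ) ^ (-(n : ℝ) / 2) := by
  by_cases h : ∃ i ∈ S, schauder n i u ≠ 0
  · obtain ⟨i, hi, hiu⟩ := h
    rw [Finset.sum_eq_single_of_mem i hi fun j _ hj => by
      rw [schauder_eq_zero_of_ne hiu hj, mul_zero], abs_mul, abs_of_nonneg (schauder_nonneg n i u)]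
    exact mul_le_mul (hz i hi) (schauder_le n i u) (schauder_nonneg n i u) hM
  · push Not at h
    rw [Finset.sum_eq_zero fun j hj => by rw [h j hj, mul_zero], abs_zero]
    positivity

lemma five_fourths_mul_two_rpow_lt_one : 5 / 4 * (2 : ℝ) ^ (-(1 : ℝ) / 2) < 1 := by
  have h : (2 : ℝ) ^ (-(1 : ℝ) / 2) = (√2)⁻¹ := by
    rw [Real.sqrt_eq_rpow, ← Real.rpow_neg (by norm_num)]
    norm_num
  rw [h, ← div_eq_mul_inv, div_lt_one (by positivity)]
  exact Real.lt_sqrt_of_sq_lt (by norm_num)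

/-- If the Gaussian coefficients of level `n` grow at most like `(5/4)^n`, a rate below `√2`, then
Lévy's series is uniformly bounded. -/
lemma abs_standardBridge_le {z : ℕ × ℕ → ℝ} {C : ℝ} (hC : 0 ≤ C)
    (hz : ∀ n, ∀ j < 2 ^ n, |z (n, j)| ≤ C * (5 / 4) ^ n) (u : ℝ) :
    |standardBridge z u| ≤ C * (1 - 5 / 4 * (2 : ℝ) ^ (-(1 : ℝ) / 2))⁻¹ := by
  rw [standardBridge, ← Real.norm_eq_abs]
  refine tsum_of_norm_bounded
    ((hasSum_geometric_of_lt_one (by positivity) five_fourths_mul_two_rpow_lt_one).mul_left C)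
    fun n => ?_
  refine (abs_sum_mul_schauder_le n u (z := fun j => z (n, j)) _ (by positivity)
    fun j hj => hz n j (Finset.mem_range.1 hj)).trans_eq ?_
  have : (2 : ℝ) ^ (-(n : ℝ) / 2) = ((2 : ℝ) ^ (-(1 : ℝ) / 2)) ^ n := by
    rw [← Real.rpow_natCast, ← Real.rpow_mul (by norm_num)]
    congr 1
    ring
  rw [this, mul_pow, mul_assoc]

/-- Markov's inequality for the fourth moment of the standard normal distribution. -/
lemma exists_gaussianReal_tail_le :
    ∃ K : ℝ, 0 ≤ K ∧ ∀ c : ℝ, 0 < c →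
      gaussianReal 0 1 {x | c < |x|} ≤ ENNReal.ofReal (K / c ^ 4) := by
  have hm : ∫⁻ x, ‖x‖ₑ ^ 4 ∂(gaussianReal 0 1) ≠ ∞ := by
    have h := (memLp_id_gaussianReal (μ := 0) (v := 1) 4).eLpNorm_lt_top
    rw [eLpNorm_lt_top_iff_lintegral_rpow_enorm_lt_top (by simp) (by simp)] at h
    simpa using h.ne
  refine ⟨(∫⁻ x, ‖x‖ₑ ^ 4 ∂(gaussianReal 0 1)).toReal, ENNReal.toReal_nonneg, fun c hc => ?_⟩
  have h := meas_ge_le_lintegral_div (μ := gaussianReal 0 1) (f := fun x : ℝ => ‖x‖ₑ ^ 4)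
    (by fun_prop) (ε := ENNReal.ofReal (c ^ 4)) (ENNReal.ofReal_pos.2 (by positivity)).ne' (by simp)
  rw [ENNReal.ofReal_div_of_pos (by positivity), ENNReal.ofReal_toReal hm]
  refine le_trans (measure_mono fun x hx => ?_) h
  have hx' : c < |x| := hx
  show ENNReal.ofReal (c ^ 4) ≤ ‖x‖ₑ ^ 4
  rw [Real.enorm_eq_ofReal_abs, ← ENNReal.ofReal_pow (abs_nonneg x)]
  exact ENNReal.ofReal_le_ofReal (pow_le_pow_left₀ hc.le hx'.le 4)

lemma exists_gaussianNoise_growth_le (d : ℕ) :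
    ∃ K : ℝ, 0 ≤ K ∧ ∀ C : ℝ, 0 < C →
      gaussianNoise d {z | ∃ i n, ∃ j < 2 ^ n, C * (5 / 4) ^ n < |z (i, n, j)|}
        ≤ ENNReal.ofReal (K / C ^ 4) := by
  obtain ⟨K, hK, hKt⟩ := exists_gaussianReal_tail_le
  refine ⟨d * K * (1 - 512 / 625 : ℝ)⁻¹, by norm_num; positivity, fun C hC => ?_⟩
  have hone : ∀ (i : Fin d) (n j : ℕ), gaussianNoise d {z | C * (5 / 4) ^ n < |z (i, n, j)|}
      ≤ ENNReal.ofReal (K / (C * (5 / 4) ^ n) ^ 4) := by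
    intro i n j
    refine le_trans (le_of_eq ?_) (hKt (C * (5 / 4) ^ n) (by positivity))
    have hmeas : MeasurableSet {x : ℝ | C * (5 / 4) ^ n < |x|} :=
      measurableSet_lt measurable_const (by fun_prop)
    have hp := measurePreserving_eval_infinitePi
      (fun _ : Fin d × ℕ × ℕ => gaussianReal 0 1) (i, n, j)
    exact hp.measure_preimage hmeas.nullMeasurableSet
  have hgeom := (hasSum_geometric_of_lt_one (r := (512 / 625 : ℝ)) (by norm_num)
    (by norm_num)).mul_left (K / C ^ 4)
  have hsub : {z : Fin d × ℕ × ℕ → ℝ | ∃ i n, ∃ j < 2 ^ n, C * (5 / 4) ^ n < |z (i, n, j)|}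
      ⊆ ⋃ i ∈ (Finset.univ : Finset (Fin d)), ⋃ n, ⋃ j ∈ Finset.range (2 ^ n),
        {z | C * (5 / 4) ^ n < |z (i, n, j)|} := by
    rintro z ⟨i, n, j, hj, h⟩
    simp only [Set.mem_iUnion, Finset.mem_range, Finset.mem_univ]
    exact ⟨i, trivial, n, j, hj, h⟩
  calc gaussianNoise d {z | ∃ i n, ∃ j < 2 ^ n, C * (5 / 4) ^ n < |z (i, n, j)|}
      ≤ ∑ i : Fin d, ∑' n : ℕ, ∑ j ∈ Finset.range (2 ^ n),
          ENNReal.ofReal (K / (C * (5 / 4) ^ n) ^ 4) := by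
        refine (measure_mono hsub).trans ((measure_biUnion_finset_le _ _).trans ?_)
        refine Finset.sum_le_sum fun i _ => (measure_iUnion_le _).trans ?_
        refine ENNReal.tsum_le_tsum fun n => (measure_biUnion_finset_le _ _).trans ?_
        exact Finset.sum_le_sum fun j _ => hone i n j
    _ = ∑ i : Fin d, ∑' n : ℕ, ENNReal.ofReal (K / C ^ 4 * (512 / 625) ^ n) := by
        refine Finset.sum_congr rfl fun i _ => tsum_congr fun n => ?_
        rw [Finset.sum_const, Finset.card_range, nsmul_eq_mul, Nat.cast_pow, Nat.cast_ofNat,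
          ← ENNReal.ofReal_ofNat, ← ENNReal.ofReal_pow (by norm_num),
          ← ENNReal.ofReal_mul (by positivity)]
        congr 1
        have h1 : ((5 / 4 : ℝ) ^ n) ^ 4 = (625 / 256) ^ n := by
          rw [← pow_mul, mul_comm, pow_mul]; norm_num
        have h2 : (512 / 625 : ℝ) ^ n = 2 ^ n / (625 / 256) ^ n := by
          rw [← div_pow]; norm_num
        rw [mul_pow, h1, h2]
        field_simp
    _ = ENNReal.ofReal (d * K * (1 - 512 / 625 : ℝ)⁻¹ / C ^ 4) := by
        rw [← ENNReal.ofReal_tsum_of_nonneg (fun n => by positivity) hgeom.summable,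
          hgeom.tsum_eq, Finset.sum_const, Finset.card_univ, Fintype.card_fin, nsmul_eq_mul,
          ← ENNReal.ofReal_natCast, ← ENNReal.ofReal_mul (by positivity)]
        congr 1
        ring

/-- With probability close to one the Brownian bridge stays within a fixed distance of its starting
point. -/
lemma exists_gaussianNoise_bridge_bounded (d : ℕ) (T : ℝ) {ε : ℝ} (hε : 0 < ε) :
    ∃ R : ℕ, ENNReal.ofReal (1 - ε) ≤ gaussianNoise d
      {z | ∀ i u, |√(2 * T) * standardBridge (fun p => z (i, p)) u| ≤ R} := by
  have : IsProbabilityMeasure (gaussianNoise d) := by unfold gaussianNoise; infer_instance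
  obtain ⟨K, hK, hKt⟩ := exists_gaussianNoise_growth_le d
  obtain ⟨C, hC, hC1⟩ : ∃ C : ℝ, 0 < C ∧ K / C ^ 4 ≤ ε := by
    refine ⟨K / ε + 1, by positivity, ?_⟩
    have h1 : 1 ≤ K / ε + 1 := by linarith [div_nonneg hK hε.le]
    have h2 : K / ε + 1 ≤ (K / ε + 1) ^ 4 := le_self_pow₀ h1 (by norm_num)
    rw [div_le_iff₀ (by positivity), ← div_le_iff₀' hε]
    linarith
  obtain ⟨R, hR⟩ := exists_nat_ge
    (√(2 * T) * (C * (1 - 5 / 4 * (2 : ℝ) ^ (-(1 : ℝ) / 2))⁻¹))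
  refine ⟨R, ?_⟩
  set B := {z : Fin d × ℕ × ℕ → ℝ | ∃ i n, ∃ j < 2 ^ n, C * (5 / 4) ^ n < |z (i, n, j)|} with hB
  have hB1 : gaussianNoise d B ≤ ENNReal.ofReal ε :=
    (hKt C hC).trans (ENNReal.ofReal_le_ofReal hC1)
  have hsub : Bᶜ ⊆ {z | ∀ i u, |√(2 * T) * standardBridge (fun p => z (i, p)) u| ≤ R} := by
    intro z hz i u
    have hz' : ∀ n, ∀ j < 2 ^ n, |z (i, n, j)| ≤ C * (5 / 4) ^ n := by
      intro n j hj
      by_contra h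
      exact hz ⟨i, n, j, hj, not_le.1 h⟩
    rw [abs_mul, abs_of_nonneg (Real.sqrt_nonneg _)]
    refine le_trans (mul_le_mul_of_nonneg_left ?_ (Real.sqrt_nonneg _)) hR
    exact abs_standardBridge_le (z := fun p => z (i, p)) hC.le hz' u
  rw [ENNReal.ofReal_sub _ hε.le, ENNReal.ofReal_one, tsub_le_iff_right]
  calc (1 : ℝ≥0∞) = gaussianNoise d (B ∪ Bᶜ) := by rw [Set.union_compl_self, measure_univ]
    _ ≤ gaussianNoise d B + gaussianNoise d Bᶜ := measure_union_le _ _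
    _ ≤ _ := by
      rw [add_comm]
      exact add_le_add (measure_mono hsub) hB1

lemma loopMass_dir_le (d N : ℕ) (t : ℝ) (x : EuclideanSpace ℝ (Fin d)) :
    loopMass d N .dir t x ≤ ENNReal.ofReal (heatKernel d t 0) := by
  have : IsProbabilityMeasure (gaussianNoise d) := by unfold gaussianNoise; infer_instance
  exact mul_le_of_le_one_right' prob_le_one

lemma lintegral_loopMass_dir_le (d N : ℕ) (t : ℝ) :
    ∫⁻ x in box d N, loopMass d N .dir t x
      ≤ ENNReal.ofReal (heatKernel d t 0) * ENNReal.ofReal (boxVolume d N) := by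
  refine (lintegral_mono fun x => loopMass_dir_le d N t x).trans_eq ?_
  rw [lintegral_const, Measure.restrict_apply_univ, volume_box]

lemma bcCycleWeight_dir_le (d N : ℕ) {β : ℝ} (hβ : 0 < β) (k : ℕ+) :
    bcCycleWeight d N .dir β 0 k ≤ cycleWeight d β 0 k := by
  have hk : 0 < (k : ℝ) := by exact_mod_cast k.pos
  have hq := cycleWeight_pos d hβ 0 k
  have hg := heatKernel_zero_pos d hβ k
  simp only [bcCycleWeight]
  split_ifs with hkN
  · have hV : 0 < boxVolume d N := boxVolume_pos d (k.pos.trans_le hkN)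
    have h := ENNReal.toReal_mono (by finiteness) (lintegral_loopMass_dir_le d N (k * β))
    rw [← ENNReal.ofReal_mul hg.le, ENNReal.toReal_ofReal (by positivity),
      heatKernel_zero_eq d hβ] at h
    refine (mul_le_mul_of_nonneg_left h (by positivity)).trans_eq ?_
    simp only [mul_zero, zero_mul, Real.exp_zero]
    field_simp
  · exact hq.le

/-- Loops rooted at distance at least `R` from the boundary stay in the box if they never leave the
`R`-neighbourhood of their root; the remaining roots fill a negligible part of the box. -/
lemma tendsto_bcCycleWeight_dir (d : ℕ) {β : ℝ} (hβ : 0 < β) (k : ℕ+) :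
    Tendsto (fun N => bcCycleWeight d N .dir β 0 k) atTop (𝓝 (cycleWeight d β 0 k)) := by
  have hk : 0 < (k : ℝ) := by exact_mod_cast k.pos
  have hq := cycleWeight_pos d hβ 0 k
  have hg := heatKernel_zero_pos d hβ k
  refine tendsto_order.2 ⟨fun b hb => ?_, fun b hb =>
    Eventually.of_forall fun N => (bcCycleWeight_dir_le d N hβ k).trans_lt hb⟩
  obtain ⟨ε, hε0, hε1, hε⟩ : ∃ ε : ℝ, 0 < ε ∧ ε < 1 ∧ b < (1 - ε) * cycleWeight d β 0 k := by
    have : Tendsto (fun ε : ℝ => (1 - ε) * cycleWeight d β 0 k) (𝓝[>] 0)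
        (𝓝 ((1 - 0) * cycleWeight d β 0 k)) :=
      (Continuous.tendsto (by fun_prop) _).mono_left nhdsWithin_le_nhds
    rw [sub_zero, one_mul] at this
    have h2 : ∀ᶠ ε : ℝ in 𝓝[>] 0, ε < 1 :=
      nhdsWithin_le_nhds (eventually_lt_nhds zero_lt_one)
    obtain ⟨ε, h⟩ := ((this.eventually_const_lt hb).and
      (h2.and self_mem_nhdsWithin)).exists
    exact ⟨ε, h.2.2, h.2.1, h.1⟩
  obtain ⟨R, hR⟩ := exists_gaussianNoise_bridge_bounded d (k * β) hε0
  have hlow : ∀ᶠ N : ℕ in atTop, (1 - ε) * cycleWeight d β 0 k *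
      (((N - R : ℕ) : ℝ) / N) ^ d ≤ bcCycleWeight d N .dir β 0 k := by
    filter_upwards [eventually_ge_atTop (k : ℕ), eventually_ge_atTop R] with N hkN hRN
    have hN : 1 ≤ N := k.pos.trans_le hkN
    have hN0 : 0 < (N : ℝ) := by exact_mod_cast hN
    have hV : 0 < boxVolume d N := boxVolume_pos d hN
    have hsub : box d (N - R) ⊆ box d N := fun x hx i =>
      (hx i).trans (Nat.cast_le.2 (Nat.sub_le N R))
    have hint : ENNReal.ofReal (heatKernel d (k * β) 0) * ENNReal.ofReal (1 - ε) *
        ENNReal.ofReal (boxVolume d (N - R)) ≤ ∫⁻ x in box d N, loopMass d N .dir (k * β) x := by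
      calc _ = ∫⁻ x in box d (N - R),
            ENNReal.ofReal (heatKernel d (k * β) 0) * ENNReal.ofReal (1 - ε) := by
            rw [lintegral_const, Measure.restrict_apply_univ, volume_box]
        _ ≤ ∫⁻ x in box d (N - R), loopMass d N .dir (k * β) x := by
            refine setLIntegral_mono' (measurableSet_box d _) fun x hx => ?_
            have hstay : {z : Fin d × ℕ × ℕ → ℝ | ∀ i u,
                |√(2 * (k * β)) * standardBridge (fun p => z (i, p)) u| ≤ R} ⊆
                {z | ∀ s ∈ Set.Icc (0 : ℝ) (k * β), brownianBridge d (k * β) x z s ∈ box d N} := by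
              intro z hz s _ i
              have h1 := hx i
              have h2 := hz i (s / (k * β))
              rw [Nat.cast_sub hRN] at h1
              exact (abs_add_le _ _).trans (by linarith)
            exact mul_le_mul_right (hR.trans (measure_mono hstay)) _
        _ ≤ _ := lintegral_mono_set hsub
    have h := ENNReal.toReal_mono (ne_top_of_le_ne_top (by finiteness)
      (lintegral_loopMass_dir_le d N (k * β))) hint
    rw [← ENNReal.ofReal_mul hg.le, ← ENNReal.ofReal_mul (by nlinarith), ENNReal.toReal_ofReal
      (mul_nonneg (mul_nonneg hg.le (by linarith)) (boxVolume_nonneg _ _)),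
      heatKernel_zero_eq d hβ] at h
    simp only [bcCycleWeight, if_pos hkN]
    refine le_trans (le_of_eq ?_) (mul_le_mul_of_nonneg_left h (by positivity))
    simp only [mul_zero, zero_mul, Real.exp_zero, boxVolume, div_pow, mul_pow]
    field_simp
  have hlim : Tendsto (fun N : ℕ => (1 - ε) * cycleWeight d β 0 k * (((N - R : ℕ) : ℝ) / N) ^ d)
      atTop (𝓝 ((1 - ε) * cycleWeight d β 0 k * 1 ^ d)) := by
    refine Tendsto.const_mul _ (Tendsto.pow ?_ d)
    have h1 : Tendsto (fun N : ℕ => 1 - (R : ℝ) / N) atTop (𝓝 (1 - 0)) :=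
      tendsto_const_nhds.sub (tendsto_const_div_atTop_nhds_zero_nat (R : ℝ))
    rw [sub_zero] at h1
    refine h1.congr' ?_
    filter_upwards [eventually_ge_atTop R, eventually_ge_atTop 1] with N hRN hN
    have : (N : ℝ) ≠ 0 := by positivity
    rw [Nat.cast_sub hRN]
    field_simp
  rw [one_pow, mul_one] at hlim
  filter_upwards [hlim.eventually_const_lt hε, hlow] with N h1 h2
  exact h1.trans_le h2

/-! ### Convergence of the finite-volume cycle weights -/

lemma exists_bcCycleWeight_le (d : ℕ) (bc : BoundaryCondition) {β : ℝ} (hβ : 0 < β) :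
    ∃ C : ℝ, 0 < C ∧ ∀ N : ℕ, 1 ≤ N → ∀ k,
      bcCycleWeight d N bc β 0 k ≤ C * cycleWeight d β 0 k := by
  cases bc with
  | empty => exact ⟨1, one_pos, fun N _ k => by simp [bcCycleWeight]⟩
  | dir => exact ⟨1, one_pos, fun N _ k => by simpa using bcCycleWeight_dir_le d N hβ k⟩
  | per =>
    have hs := summable_int_exp_neg_sq (c := β⁻¹) (by positivity)
    refine ⟨(∑' z : ℤ, Real.exp (-(β⁻¹ * (z : ℝ) ^ 2))) ^ d, pow_pos ?_ d, fun N hN k => ?_⟩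
    · exact hs.tsum_pos (fun z => (Real.exp_pos _).le) 0 (Real.exp_pos _)
    have hq := cycleWeight_pos d hβ 0 k
    by_cases hkN : (k : ℕ) ≤ N
    · refine (bcCycleWeight_per_bounds d hβ k hkN).2.trans (mul_le_mul_of_nonneg_right ?_ hq.le)
      have hN1 : (1 : ℝ) ≤ N := by exact_mod_cast hN
      refine pow_le_pow_left₀ (tsum_nonneg fun z => (Real.exp_pos _).le) ?_ d
      refine (summable_int_exp_neg_sq (by positivity)).tsum_le_tsum (fun z => ?_) hs
      rw [Real.exp_le_exp, neg_le_neg_iff, mul_assoc]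
      exact le_mul_of_one_le_left (by positivity) hN1
    · simp only [bcCycleWeight, if_neg hkN]
      exact mul_nonneg (pow_nonneg (tsum_nonneg fun z => (Real.exp_pos _).le) d) hq.le

lemma tendsto_bcCycleWeight (d : ℕ) (bc : BoundaryCondition) {β : ℝ} (hβ : 0 < β) (k : ℕ+) :
    Tendsto (fun N => bcCycleWeight d N bc β 0 k) atTop (𝓝 (cycleWeight d β 0 k)) := by
  cases bc with
  | empty => exact tendsto_const_nhds
  | dir => exact tendsto_bcCycleWeight_dir d hβ k
  | per =>
    have h := ((tendsto_tsum_int_exp_neg_sq (c := β⁻¹) (by positivity)).pow d).mul_const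
      (cycleWeight d β 0 k)
    rw [one_pow, one_mul] at h
    refine tendsto_of_tendsto_of_tendsto_of_le_of_le' tendsto_const_nhds h ?_ ?_
    · filter_upwards [eventually_ge_atTop (k : ℕ)] with N hN
      exact (bcCycleWeight_per_bounds d hβ k hN).1
    · filter_upwards [eventually_ge_atTop (k : ℕ)] with N hN
      exact (bcCycleWeight_per_bounds d hβ k hN).2

/-! ### The sequence space -/

lemma memℓp_one_iff {y : ℕ+ → ℝ} : Memℓp y 1 ↔ Summable fun k => |y k| := by
  rw [memℓp_gen_iff (by simp)]
  simp

lemma EllOne.summable_abs (x : EllOne) : Summable fun k => |x k| :=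
  memℓp_one_iff.1 (lp.memℓp x)

lemma EllOne.summable (x : EllOne) : Summable fun k => x k := x.summable_abs.of_abs

lemma EllOne.norm_eq (x : EllOne) : ‖x‖ = ∑' k, |x k| := by
  rw [lp.norm_eq_tsum_rpow (by simp)]
  simp

lemma EllOne.continuous_coord (k : ℕ+) : Continuous fun x : EllOne => x k :=
  (continuous_apply k).comp (lp.uniformContinuous_coe.continuous)

lemma isClosed_ellOneNonneg : IsClosed ellOneNonneg := by
  have : ellOneNonneg = ⋂ k : ℕ+, {x : EllOne | 0 ≤ x k} := by
    ext x; simp [ellOneNonneg]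
  rw [this]
  exact isClosed_iInter fun k => isClosed_le continuous_const (EllOne.continuous_coord k)

lemma EllOne.tendsto_of_dominated {ι : Type*} {l : Filter ι} {f : ι → EllOne} {x : EllOne}
    {bound : ℕ+ → ℝ} (hb : Summable bound) (hp : ∀ k, Tendsto (fun i => f i k) l (𝓝 (x k)))
    (hle : ∀ᶠ i in l, ∀ k, |f i k - x k| ≤ bound k) : Tendsto f l (𝓝 x) := by
  rw [tendsto_iff_norm_sub_tendsto_zero]
  have h0 : ∑' _ : ℕ+, (0 : ℝ) = 0 := tsum_zero
  rw [← h0]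
  have h : (fun i => ‖f i - x‖) = fun i => ∑' k, |f i k - x k| := by
    ext i
    rw [EllOne.norm_eq]
    rfl
  rw [h]
  refine tendsto_tsum_of_dominated_convergence hb (fun k => ?_) ?_
  · simpa using ((hp k).sub_const (x k)).abs
  · filter_upwards [hle] with i hi k
    simpa using hi k

lemma tendsto_Ico_one_atTop : Tendsto (fun n : ℕ+ => Finset.Ico 1 n) atTop atTop := by
  refine tendsto_atTop_finset_of_monotone (fun a b hab => Finset.Ico_subset_Ico_right hab)
    fun k => ⟨k + 1, ?_⟩
  simp

lemma tendsto_pnat_cast_atTop : Tendsto (fun n : ℕ+ => (n : ℝ)) atTop atTop := by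
  refine tendsto_atTop_atTop.2 fun b => ?_
  obtain ⟨n, hn⟩ := exists_nat_ge b
  refine ⟨⟨n + 1, n.succ_pos⟩, fun m hm => hn.trans ?_⟩
  have : n + 1 ≤ (m : ℕ) := hm
  exact_mod_cast (Nat.le_succ n).trans this

/-- The sequence `x` cut off at `n`, with an extra density `ρ` put into cycles of length `n`. -/
noncomputable def truncateAddMass (x : EllOne) (ρ : ℝ) (n : ℕ+) : EllOne :=
  ⟨fun k => if k < n then x k else if k = n then ρ / n else 0, by
    refine memℓp_one_iff.2 (summable_of_hasFiniteSupport ((Set.finite_Icc 1 n).subset ?_))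
    intro k hk
    refine ⟨one_le, ?_⟩
    by_contra h
    rw [not_le] at h
    refine hk ?_
    simp [not_lt.2 h.le, h.ne']⟩

lemma truncateAddMass_apply (x : EllOne) (ρ : ℝ) (n k : ℕ+) :
    truncateAddMass x ρ n k = if k < n then x k else if k = n then ρ / n else 0 := rfl

lemma truncateAddMass_nonneg {x : EllOne} (hx : x ∈ ellOneNonneg) {ρ : ℝ} (hρ : 0 ≤ ρ) (n : ℕ+) :
    truncateAddMass x ρ n ∈ ellOneNonneg := by
  intro k
  rw [truncateAddMass_apply]
  split_ifs
  · exact hx k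
  · positivity
  · exact le_rfl

lemma tendsto_truncateAddMass (x : EllOne) (ρ : ℝ) :
    Tendsto (truncateAddMass x ρ) atTop (𝓝 x) := by
  have h1 : Tendsto (truncateAddMass x 0) atTop (𝓝 x) := by
    refine EllOne.tendsto_of_dominated x.summable_abs (fun k => ?_) (.of_forall fun n k => ?_)
    · refine tendsto_const_nhds.congr' ?_
      filter_upwards [eventually_gt_atTop k] with n hn
      rw [truncateAddMass_apply, if_pos hn]
    · rw [truncateAddMass_apply]
      split_ifs <;> simp
  have h2 : Tendsto (fun n : ℕ+ => (lp.single 1 n (ρ / n) : EllOne)) atTop (𝓝 0) := by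
    rw [tendsto_zero_iff_norm_tendsto_zero]
    simp_rw [lp.norm_single one_pos]
    rw [← tendsto_zero_iff_norm_tendsto_zero]
    exact tendsto_const_nhds.div_atTop tendsto_pnat_cast_atTop
  have h3 := h1.add h2
  rw [add_zero] at h3
  refine h3.congr fun n => ?_
  ext k
  rw [lp.coeFn_add, Pi.add_apply, truncateAddMass_apply, truncateAddMass_apply]
  rcases lt_trichotomy k n with h | h | h
  · simp [h, h.ne]
  · subst h; simp
  · simp [not_lt.2 h.le, h.ne']

/-! ### The density and the lower semicontinuous regularisation of the Hamiltonian -/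

lemma lowerSemicontinuous_density : LowerSemicontinuous density :=
  lowerSemicontinuous_tsum fun k => (ENNReal.continuous_ofReal.comp
    ((EllOne.continuous_coord k).const_mul _)).lowerSemicontinuous

lemma density_eq_sum {y : EllOne} (hy : y ∈ ellOneNonneg) (S : Finset ℕ+)
    (hS : ∀ k ∉ S, y k = 0) : density y = ENNReal.ofReal (∑ k ∈ S, (k : ℝ) * y k) := by
  rw [density, tsum_eq_sum (s := S) fun k hk => by simp [hS k hk],
    ENNReal.ofReal_sum_of_nonneg fun k _ => mul_nonneg (by positivity) (hy k)]

lemma hasSum_density {x : EllOne} (hx : x ∈ ellOneNonneg) (hD : density x ≠ ∞) :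
    HasSum (fun k : ℕ+ => (k : ℝ) * x k) (density x).toReal := by
  have h := ENNReal.hasSum_toReal hD
  simp_rw [ENNReal.toReal_ofReal (mul_nonneg (Nat.cast_nonneg _) (hx _))] at h
  rw [density, ENNReal.tsum_toReal_eq (ENNReal.ne_top_of_tsum_ne_top hD)]
  simpa only [ENNReal.toReal_ofReal (mul_nonneg (Nat.cast_nonneg _) (hx _))] using h

lemma sum_truncateAddMass (x : EllOne) (ρ : ℝ) (n : ℕ+) :
    ∑ k ∈ Finset.Icc 1 n, (k : ℝ) * truncateAddMass x ρ n k
      = ∑ k ∈ Finset.Ico 1 n, (k : ℝ) * x k + ρ := by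
  rw [← Finset.Ico_insert_right one_le, Finset.sum_insert (by simp), add_comm]
  congr 1
  · refine Finset.sum_congr rfl fun k hk => ?_
    rw [truncateAddMass_apply, if_pos (Finset.mem_Ico.1 hk).2]
  · rw [truncateAddMass_apply, if_neg (lt_irrefl _), if_pos rfl]
    field_simp

lemma truncateAddMass_eq_zero (x : EllOne) (ρ : ℝ) (n : ℕ+) {k : ℕ+} (hk : k ∉ Finset.Icc 1 n) :
    truncateAddMass x ρ n k = 0 := by
  have h : n < k := by
    by_contra h
    exact hk (Finset.mem_Icc.2 ⟨one_le, not_lt.1 h⟩)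
  rw [truncateAddMass_apply, if_neg (not_lt.2 h.le), if_neg h.ne']

lemma tendsto_sum_truncateAddMass {x : EllOne} (hx : x ∈ ellOneNonneg) (hD : density x ≠ ∞)
    (ρ : ℝ) :
    Tendsto (fun n : ℕ+ => ∑ k ∈ Finset.Icc 1 n, (k : ℝ) * truncateAddMass x ρ n k) atTop
      (𝓝 ((density x).toReal + ρ)) := by
  simp_rw [sum_truncateAddMass]
  exact Tendsto.add_const ρ ((hasSum_density hx hD).comp tendsto_Ico_one_atTop)

lemma LowerSemicontinuous.ite_top {X : Type*} [TopologicalSpace X] {C : Set X} (hC : IsClosed C)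
    [DecidablePred (· ∈ C)] {f : X → EReal} (hf : LowerSemicontinuous f) :
    LowerSemicontinuous fun x => if x ∈ C then f x else ⊤ := by
  intro x c hc
  by_cases hx : x ∈ C
  · simp only [if_pos hx] at hc
    filter_upwards [hf x c hc] with y hy
    split_ifs
    · exact hy
    · exact hy.trans_le le_top
  · simp only [if_neg hx] at hc
    filter_upwards [hC.isOpen_compl.mem_nhds hx] with y hy
    rw [if_neg hy]
    exact hc

/-- The largest nondecreasing function below the mean-field energy: it is constant up to the
minimiser `m / a` of the parabola (if that is positive) and equal to the energy beyond. -/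
noncomputable def meanFieldEnvelope (a m : ℝ) (D : ℝ≥0∞) : EReal :=
  if D = ∞ then ⊤
  else ((-(m ^ 2 / (2 * a)) + a / 2 * max (D.toReal - m / a) 0 ^ 2 : ℝ) : EReal)

lemma meanFieldEnvelope_eq_add {a : ℝ} (ha : 0 < a) (m : ℝ) (D : ℝ≥0∞) :
    meanFieldEnvelope a m D = ((-(m ^ 2 / (2 * a)) : ℝ) : EReal) + ((ENNReal.ofReal (a / 2) *
      (D + ENNReal.ofReal (-(m / a)) - ENNReal.ofReal (m / a)) ^ 2 : ℝ≥0∞) : EReal) := by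
  unfold meanFieldEnvelope
  split_ifs with hD
  · rw [hD, top_add, ENNReal.top_sub ENNReal.ofReal_ne_top, ENNReal.top_pow two_ne_zero,
      ENNReal.mul_top (by simpa using ha)]
    simp
  · have h : D + ENNReal.ofReal (-(m / a)) - ENNReal.ofReal (m / a)
        = ENNReal.ofReal (max (D.toReal - m / a) 0) := by
      lift D to ℝ≥0 using hD
      rw [ENNReal.coe_toReal, ← ENNReal.ofReal_coe_nnreal]
      rcases le_total 0 (m / a) with h | h
      · rw [ENNReal.ofReal_of_nonpos (p := -(m / a)) (by linarith), add_zero,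
          ← ENNReal.ofReal_sub _ h]
        simp [ENNReal.ofReal, Real.toNNReal]
      · rw [ENNReal.ofReal_of_nonpos (p := m / a) h, tsub_zero,
          ← ENNReal.ofReal_add D.coe_nonneg (by linarith)]
        have := D.coe_nonneg
        rw [max_eq_left (by linarith), sub_eq_add_neg]
    have hnn : 0 ≤ a / 2 * max (D.toReal - m / a) 0 ^ 2 := by positivity
    rw [h, ← ENNReal.ofReal_pow (le_max_right _ _), ← ENNReal.ofReal_mul (by linarith),
      EReal.coe_ennreal_ofReal, max_eq_left hnn, EReal.coe_add]

lemma meanFieldEnvelope_eq_energy {a : ℝ} (ha : 0 < a) (m : ℝ) {D : ℝ≥0∞} (hD : D ≠ ∞) :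
    meanFieldEnvelope a m D = ((-m * max D.toReal (m / a) + a / 2 * max D.toReal (m / a) ^ 2 : ℝ) :
      EReal) := by
  rw [meanFieldEnvelope, if_neg hD]
  congr 1
  rcases le_total D.toReal (m / a) with h | h
  · rw [max_eq_right h, max_eq_right (by linarith)]
    field_simp
    ring
  · rw [max_eq_left h, max_eq_left (by linarith)]
    field_simp
    ring

lemma meanFieldEnvelope_ge (a m : ℝ) (ha : 0 < a) (D : ℝ≥0∞) :
    ((-(m ^ 2 / (2 * a)) : ℝ) : EReal) ≤ meanFieldEnvelope a m D := by
  unfold meanFieldEnvelope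
  split_ifs
  · exact le_top
  · rw [EReal.coe_le_coe_iff]
    have : 0 ≤ a / 2 * max (D.toReal - m / a) 0 ^ 2 := by positivity
    linarith

lemma meanFieldEnvelope_le_energy {a : ℝ} (ha : 0 < a) (m : ℝ) (D : ℝ≥0∞) :
    meanFieldEnvelope a m D ≤ meanFieldEnergy a m D := by
  unfold meanFieldEnvelope meanFieldEnergy
  split_ifs
  · exact le_rfl
  · rw [EReal.coe_le_coe_iff]
    have h1 : -m * D.toReal + a / 2 * D.toReal ^ 2
        = -(m ^ 2 / (2 * a)) + a / 2 * (D.toReal - m / a) ^ 2 := by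
      field_simp
      ring
    rw [h1]
    have h2 : max (D.toReal - m / a) 0 ^ 2 ≤ (D.toReal - m / a) ^ 2 := by
      rcases le_total (D.toReal - m / a) 0 with h | h
      · rw [max_eq_right h]; nlinarith [sq_nonneg (D.toReal - m / a)]
      · rw [max_eq_left h]
    have := mul_le_mul_of_nonneg_left h2 (by positivity : 0 ≤ a / 2)
    linarith

lemma lowerSemicontinuous_meanFieldEnvelope_density {a : ℝ} (ha : 0 < a) (m : ℝ) :
    LowerSemicontinuous fun x => meanFieldEnvelope a m (density x) := by
  simp_rw [meanFieldEnvelope_eq_add ha]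
  refine LowerSemicontinuous.add' lowerSemicontinuous_const ?_ fun x =>
    EReal.continuousAt_add (.inl (EReal.coe_ne_top _)) (.inl (EReal.coe_ne_bot _))
  have hc : Continuous fun D : ℝ≥0∞ => ((ENNReal.ofReal (a / 2) *
      (D + ENNReal.ofReal (-(m / a)) - ENNReal.ofReal (m / a)) ^ 2 : ℝ≥0∞) : EReal) := by
    refine continuous_coe_ennreal_ereal.comp
      ((ENNReal.continuous_const_mul ENNReal.ofReal_ne_top).comp ?_)
    refine (ENNReal.continuous_pow 2).comp ((ENNReal.continuous_sub_right _).comp ?_)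
    exact continuous_id.add continuous_const
  refine hc.comp_lowerSemicontinuous lowerSemicontinuous_density fun D E hDE => ?_
  exact EReal.coe_ennreal_le_coe_ennreal_iff.2 (by gcongr)

lemma lscRegularisation_le {X : Type*} [TopologicalSpace X] (f : X → EReal) (x : X) :
    lscRegularisation f x ≤ f x :=
  iSup₂_le fun _ hg => hg.2 x

lemma lowerSemicontinuous_lscRegularisation {X : Type*} [TopologicalSpace X] (f : X → EReal) :
    LowerSemicontinuous (lscRegularisation f) :=
  lowerSemicontinuous_biSup fun _ hg => hg.1

lemma pmfHamiltonian_eq_of_ne_top {y : EllOne} (hy : y ∈ ellOneNonneg) (a m : ℝ)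
    (hD : density y ≠ ∞) : pmfHamiltonian a m y =
      ((-m * (density y).toReal + a / 2 * (density y).toReal ^ 2 : ℝ) : EReal) := by
  rw [pmfHamiltonian, if_pos hy, meanFieldEnergy, if_neg hD]

open Classical in
/-- The regularised Hamiltonian is the monotone envelope of the energy at the density: density may
be added at infinitesimal `ℓ₁`-cost through ever longer cycles, while the density itself is lower
semicontinuous. -/
lemma pmfHamiltonianLsc_eq {a : ℝ} (ha : 0 < a) (m : ℝ) (x : EllOne) :
    pmfHamiltonianLsc a m x
      = if x ∈ ellOneNonneg then meanFieldEnvelope a m (density x) else ⊤ := by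
  refine le_antisymm ?_ ?_
  · split_ifs with hx
    swap
    · exact le_top
    by_cases hD : density x = ∞
    · simp [meanFieldEnvelope, hD]
    refine le_of_forall_gt fun c hc => ?_
    by_contra hcon
    rw [not_lt] at hcon
    rw [meanFieldEnvelope_eq_energy ha m hD] at hc
    obtain ⟨c', hc1, hc2⟩ := exists_between hc
    have hρ : 0 ≤ max (m / a - (density x).toReal) 0 := le_max_right _ _
    set ρ := max (m / a - (density x).toReal) 0 with hρdef
    have hmax : max (density x).toReal (m / a) = (density x).toReal + ρ := by
      rw [hρdef, ← max_add_add_left, max_comm]; simp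
    have h1 := (tendsto_truncateAddMass x ρ).eventually
      (lowerSemicontinuous_lscRegularisation (pmfHamiltonian a m) x c' (hc2.trans_le hcon))
    have h2 := tendsto_sum_truncateAddMass hx hD ρ
    rw [← hmax] at h2
    have h3 := (((continuous_const.mul continuous_id).add (continuous_const.mul
      (continuous_id.pow 2)) : Continuous fun D : ℝ => -m * D + a / 2 * D ^ 2).tendsto _).comp h2
    have h4 := (continuous_coe_real_ereal.tendsto _).comp h3
    obtain ⟨n, hn1, hn2⟩ := (h1.and (h4.eventually_lt_const hc1)).exists
    have hy := truncateAddMass_nonneg hx hρ n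
    have hd := density_eq_sum hy _ fun k hk => truncateAddMass_eq_zero x ρ n hk
    have hle := lscRegularisation_le (pmfHamiltonian a m) (truncateAddMass x ρ n)
    rw [pmfHamiltonian_eq_of_ne_top hy a m (by rw [hd]; exact ENNReal.ofReal_ne_top), hd,
      ENNReal.toReal_ofReal (Finset.sum_nonneg fun k _ =>
        mul_nonneg (Nat.cast_nonneg _) (hy k))] at hle
    exact lt_irrefl _ (hn1.trans_le (hle.trans hn2.le))
  · refine le_iSup₂_of_le
      (fun x => if x ∈ ellOneNonneg then meanFieldEnvelope a m (density x) else ⊤)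
      ⟨(lowerSemicontinuous_meanFieldEnvelope_density ha m).ite_top isClosed_ellOneNonneg,
        fun y => ?_⟩ le_rfl
    simp only [pmfHamiltonian]
    split_ifs
    · exact meanFieldEnvelope_le_energy ha m _
    · exact le_rfl

lemma pmfHamiltonianLsc_eq_sub {a : ℝ} (ha : 0 < a) (m : ℝ) {x : EllOne}
    (hx : x ∈ ellOneNonneg) :
    pmfHamiltonianLsc a m x = pmfHamiltonian a m x - ((1 / (2 * a) : ℝ) : EReal) *
      (max ((m : EReal) - (a : EReal) * (density x : EReal)) 0) ^ 2 := by
  rw [pmfHamiltonianLsc_eq ha, if_pos hx]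
  by_cases hD : density x = ∞
  · rw [pmfHamiltonian, if_pos hx, hD]
    simp [meanFieldEnvelope, meanFieldEnergy, EReal.coe_mul_top_of_pos ha]
  · rw [pmfHamiltonian_eq_of_ne_top hx a m hD, meanFieldEnvelope_eq_energy ha m hD]
    set D := (density x).toReal
    have hDe : (density x : EReal) = (D : EReal) := by
      rw [← EReal.coe_toReal (x := (density x : EReal)) (by simpa using hD) (by simp)]
      simp [D]
    rw [hDe, ← EReal.coe_mul, ← EReal.coe_sub, ← EReal.coe_zero,
      ← EReal.coe_strictMono.monotone.map_max, ← EReal.coe_pow, ← EReal.coe_mul, ← EReal.coe_sub]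
    congr 1
    rcases le_total D (m / a) with h | h
    · rw [max_eq_right h, max_eq_left (by rw [le_div_iff₀ ha] at h; linarith)]
      field_simp
      ring
    · rw [max_eq_left h, max_eq_right (by rw [div_le_iff₀ ha] at h; linarith)]
      ring

lemma pmfHamiltonianLsc_eq_ite {a : ℝ} (ha : 0 < a) (m : ℝ) {x : EllOne}
    (hx : x ∈ ellOneNonneg) :
    pmfHamiltonianLsc a m x =
      if ((m / a : ℝ) : EReal) ≤ (density x : EReal) then meanFieldEnergy a m (density x)
      else ((-(m ^ 2 / (2 * a)) : ℝ) : EReal) := by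
  rw [pmfHamiltonianLsc_eq ha, if_pos hx]
  by_cases hD : density x = ∞
  · simp [hD, meanFieldEnvelope, meanFieldEnergy]
  · have hDe : (density x : EReal) = ((density x).toReal : EReal) := by
      rw [← EReal.coe_toReal (x := (density x : EReal)) (by simpa using hD) (by simp)]
      simp
    by_cases h : m / a ≤ (density x).toReal
    · rw [if_pos (by rwa [hDe, EReal.coe_le_coe_iff]), meanFieldEnvelope_eq_energy ha m hD,
        meanFieldEnergy, if_neg hD, max_eq_left h]
    · rw [if_neg (by rwa [hDe, EReal.coe_le_coe_iff]), meanFieldEnvelope, if_neg hD,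
        max_eq_right (by linarith)]
      simp

/-! ### The rate function of the ideal gas -/

lemma mul_log_div_sub_add_nonneg {q x : ℝ} (hq : 0 < q) (hx : 0 ≤ x) :
    0 ≤ x * Real.log (x / q) - x + q := by
  rcases hx.eq_or_lt with rfl | hx
  · simpa using hq.le
  · have h := Real.one_sub_inv_le_log_of_pos (div_pos hx hq)
    have h2 := mul_le_mul_of_nonneg_left h hx.le
    have h3 : x * (1 - (x / q)⁻¹) = x - q := by field_simp
    linarith

lemma continuous_mul_log_div {q : ℝ} (hq : 0 < q) : Continuous fun x => x * Real.log (x / q) := by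
  have h := (Real.continuous_mul_log.comp (continuous_id.div_const q)).const_mul q
  refine h.congr fun x => ?_
  simp only [Function.comp_apply, id]
  field_simp

lemma idealRate_nonneg (d : ℕ) (β α : ℝ) (x : EllOne) : 0 ≤ idealRate d β α x := by
  unfold idealRate
  split_ifs
  · exact EReal.coe_ennreal_nonneg _
  · exact le_top

lemma lowerSemicontinuous_idealRate (d : ℕ) {β : ℝ} (hβ : 0 < β) (α : ℝ) :
    LowerSemicontinuous (idealRate d β α) := by
  classical
  refine LowerSemicontinuous.ite_top isClosed_ellOneNonneg ?_
  refine continuous_coe_ennreal_ereal.comp_lowerSemicontinuous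
    (lowerSemicontinuous_tsum fun k => Continuous.lowerSemicontinuous ?_)
    fun _ _ h => EReal.coe_ennreal_le_coe_ennreal_iff.2 h
  refine ENNReal.continuous_ofReal.comp ?_
  have hk := EllOne.continuous_coord k
  exact (((continuous_mul_log_div (cycleWeight_pos d hβ α k)).comp hk).sub hk).add
    continuous_const

/-- The Legendre dual of a finite sum of Poisson rate functions, approximated from below: a zero
coordinate needs an exponent tending to `-∞`. -/
lemma exists_lt_sum_sub_exp {S : Finset ℕ+} {q x : ℕ+ → ℝ} (hq : ∀ k, 0 < q k)
    (hx : ∀ k, 0 ≤ x k) {L : ℝ}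
    (hL : L < ∑ k ∈ S, (x k * Real.log (x k / q k) - x k + q k)) :
    ∃ t : ℕ+ → ℝ, L < ∑ k ∈ S, (t k * x k - q k * (Real.exp (t k) - 1)) := by
  have key : ∀ k ∈ S, Tendsto (fun δ : ℝ => Real.log (max (x k) δ / q k) * x k
      - q k * (Real.exp (Real.log (max (x k) δ / q k)) - 1)) (𝓝[>] 0)
      (𝓝 (x k * Real.log (x k / q k) - x k + q k)) := by
    intro k _
    have hev : ∀ᶠ δ : ℝ in 𝓝[>] 0, Real.exp (Real.log (max (x k) δ / q k)) = max (x k) δ / q k := by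
      filter_upwards [self_mem_nhdsWithin] with δ hδ
      exact Real.exp_log (div_pos (lt_max_of_lt_right hδ) (hq k))
    have hmax : Tendsto (fun δ : ℝ => max (x k) δ) (𝓝[>] 0) (𝓝 (max (x k) 0)) :=
      (continuous_const.max continuous_id).continuousAt.tendsto.mono_left nhdsWithin_le_nhds
    rw [max_eq_left (hx k)] at hmax
    have hlog : Tendsto (fun δ : ℝ => Real.log (max (x k) δ / q k) * x k) (𝓝[>] 0)
        (𝓝 (x k * Real.log (x k / q k))) := by
      rcases (hx k).eq_or_lt with h0 | h0
      · simp [← h0]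
      · rw [mul_comm (x k)]
        exact ((hmax.div_const (q k)).log (div_pos h0 (hq k)).ne').mul_const (x k)
    have h := hlog.sub (hmax.sub_const (q k))
    have he : x k * Real.log (x k / q k) - x k + q k
        = x k * Real.log (x k / q k) - (x k - q k) := by ring
    rw [he]
    refine h.congr' ?_
    filter_upwards [hev] with δ hδ
    rw [hδ, mul_sub, mul_div_cancel₀ _ (hq k).ne', mul_one]
  obtain ⟨δ, hδ⟩ := ((tendsto_finsetSum S key).eventually_const_lt hL).exists
  exact ⟨_, hδ⟩

lemma exists_lt_of_lt_idealRate (d : ℕ) {β : ℝ} (hβ : 0 < β) {x : EllOne} {L : ℝ}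
    (hL : (L : EReal) < idealRate d β 0 x) :
    ∃ (S : Finset ℕ+) (t : ℕ+ → ℝ),
      L < ∑ k ∈ S, (t k * x k - cycleWeight d β 0 k * (Real.exp (t k) - 1)) := by
  have hq := fun k => cycleWeight_pos d hβ 0 k
  by_cases hx : x ∈ ellOneNonneg
  · rw [idealRate, if_pos hx] at hL
    have hf := fun k => mul_log_div_sub_add_nonneg (hq k) (hx k)
    rcases lt_or_ge L 0 with h0 | h0
    · exact ⟨∅, 0, by simpa using h0⟩
    have hL' : ENNReal.ofReal L < ∑' k : ℕ+, ENNReal.ofReal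
        (x k * Real.log (x k / cycleWeight d β 0 k) - x k + cycleWeight d β 0 k) := by
      rw [← EReal.coe_ennreal_lt_coe_ennreal_iff, EReal.coe_ennreal_ofReal, max_eq_left h0]
      exact hL
    rw [ENNReal.tsum_eq_iSup_sum, lt_iSup_iff] at hL'
    obtain ⟨S, hS⟩ := hL'
    rw [← ENNReal.ofReal_sum_of_nonneg fun k _ => hf k,
      ENNReal.ofReal_lt_ofReal_iff_of_nonneg h0] at hS
    obtain ⟨t, ht⟩ := exists_lt_sum_sub_exp hq hx hS
    exact ⟨S, t, ht⟩
  · simp only [ellOneNonneg, Set.mem_ofPred_eq, not_forall, not_le] at hx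
    obtain ⟨k, hk⟩ := hx
    obtain ⟨n, hn⟩ := exists_nat_gt (L / (-x k))
    refine ⟨{k}, fun _ => -(n : ℝ), ?_⟩
    rw [div_lt_iff₀ (by linarith)] at hn
    have h1 : Real.exp (-(n : ℝ)) ≤ 1 := Real.exp_le_one_iff.2 (by simp)
    have h2 := mul_nonneg (hq k).le (sub_nonneg.2 h1)
    rw [Finset.sum_singleton]
    linarith

/-! ### The unnormalised rate function -/

/-- The rate function of the particle-mean-field model before subtraction of its infimum. -/
noncomputable def pmfFunctional (d : ℕ) (β a m : ℝ) (x : EllOne) : EReal :=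
  (β : EReal) * pmfHamiltonianLsc a m x + idealRate d β 0 x

lemma pmfHamiltonianLsc_ge {a : ℝ} (ha : 0 < a) (m : ℝ) (x : EllOne) :
    ((-(m ^ 2 / (2 * a)) : ℝ) : EReal) ≤ pmfHamiltonianLsc a m x := by
  classical
  rw [pmfHamiltonianLsc_eq ha]
  split_ifs
  · exact meanFieldEnvelope_ge a m ha _
  · exact le_top

lemma coe_mul_pmfHamiltonianLsc_ge {β a : ℝ} (hβ : 0 < β) (ha : 0 < a) (m : ℝ) (x : EllOne) :
    ((β * -(m ^ 2 / (2 * a)) : ℝ) : EReal) ≤ (β : EReal) * pmfHamiltonianLsc a m x := by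
  rw [EReal.coe_mul]
  exact mul_le_mul_of_nonneg_left (pmfHamiltonianLsc_ge ha m x) (EReal.coe_nonneg.2 hβ.le)

lemma pmfFunctional_ge (d : ℕ) {β a : ℝ} (hβ : 0 < β) (ha : 0 < a) (m : ℝ) (x : EllOne) :
    ((β * -(m ^ 2 / (2 * a)) : ℝ) : EReal) ≤ pmfFunctional d β a m x := by
  have h := add_le_add (coe_mul_pmfHamiltonianLsc_ge hβ ha m x) (idealRate_nonneg d β 0 x)
  rwa [add_zero] at h

lemma lowerSemicontinuous_pmfFunctional (d : ℕ) {β a : ℝ} (hβ : 0 < β) (ha : 0 < a) (m : ℝ) :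
    LowerSemicontinuous (pmfFunctional d β a m) := by
  refine LowerSemicontinuous.add' ?_ (lowerSemicontinuous_idealRate d hβ 0) fun x =>
    EReal.continuousAt_add (.inr ?_) (.inl ?_)
  · have hc : Continuous fun e : EReal => (β : EReal) * e := by
      refine continuous_iff_continuousAt.2 fun e => ?_
      exact (EReal.continuousAt_mul (p := ((β : EReal), e)) (.inl (by simpa using hβ.ne'))
        (.inl (by simpa using hβ.ne')) (.inl (EReal.coe_ne_bot _))
        (.inl (EReal.coe_ne_top _))).comp (continuousAt_const.prodMk continuousAt_id)
    exact hc.comp_lowerSemicontinuous (lowerSemicontinuous_lscRegularisation _)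
      fun _ _ h => mul_le_mul_of_nonneg_left h (EReal.coe_nonneg.2 hβ.le)
  · exact ne_bot_of_le_ne_bot (by simp) (idealRate_nonneg d β 0 x)
  · exact ne_bot_of_le_ne_bot (EReal.coe_ne_bot _) (coe_mul_pmfHamiltonianLsc_ge hβ ha m x)

lemma zero_mem_ellOneNonneg : (0 : EllOne) ∈ ellOneNonneg := fun k => by simp

lemma idealRate_zero {d : ℕ} (hd : 1 ≤ d) {β : ℝ} (hβ : 0 < β) :
    idealRate d β 0 0 = ((∑' k, cycleWeight d β 0 k : ℝ) : EReal) := by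
  rw [idealRate, if_pos zero_mem_ellOneNonneg]
  simp only [lp.coeFn_zero, Pi.zero_apply, zero_mul, sub_zero, zero_add]
  have hq := fun k => (cycleWeight_pos d hβ 0 k).le
  rw [← ENNReal.ofReal_tsum_of_nonneg hq (summable_cycleWeight_zero hd β),
    EReal.coe_ennreal_ofReal, max_eq_left (tsum_nonneg hq)]

lemma exists_iInf_pmfFunctional_eq {d : ℕ} (hd : 1 ≤ d) {β a : ℝ} (hβ : 0 < β) (ha : 0 < a)
    (m : ℝ) : ∃ r : ℝ, ⨅ x, pmfFunctional d β a m x = (r : EReal) := by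
  have hlow : ((β * -(m ^ 2 / (2 * a)) : ℝ) : EReal) ≤ ⨅ x, pmfFunctional d β a m x :=
    le_iInf fun x => pmfFunctional_ge d hβ ha m x
  have hup : ⨅ x, pmfFunctional d β a m x ≠ ⊤ := by
    refine ne_top_of_le_ne_top ?_ (iInf_le _ 0)
    have hD : density 0 = 0 := by simp [density]
    rw [pmfFunctional, idealRate_zero hd hβ, pmfHamiltonianLsc_eq_ite ha m zero_mem_ellOneNonneg,
      hD]
    simp only [meanFieldEnergy, if_neg ENNReal.zero_ne_top]
    split_ifs <;> rw [← EReal.coe_mul, ← EReal.coe_add] <;> exact EReal.coe_ne_top _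
  exact ⟨_, (EReal.coe_toReal hup (ne_bot_of_le_ne_bot (EReal.coe_ne_bot _) hlow)).symm⟩

/-- Near `x`, the Hamiltonian is bounded below by a constant and the entropy by an affine
function of finitely many coordinates, at a total value above any `L` below the rate. -/
lemma exists_nhds_of_lt_pmfFunctional (d : ℕ) {β a : ℝ} (hβ : 0 < β) (ha : 0 < a) {m : ℝ}
    {x : EllOne} {L : ℝ} (hL : (L : EReal) < pmfFunctional d β a m x) :
    ∃ (U : Set EllOne) (h b : ℝ) (S : Finset ℕ+) (t : ℕ+ → ℝ), IsOpen U ∧ x ∈ U ∧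
      (∀ y ∈ U, (h : EReal) ≤ pmfHamiltonian a m y) ∧ (∀ y ∈ U, b ≤ ∑ k ∈ S, t k * y k) ∧
      L < β * h + b - ∑ k ∈ S, cycleWeight d β 0 k * (Real.exp (t k) - 1) := by
  obtain ⟨h, L₂, hh, hL₂, hsum⟩ : ∃ h L₂ : ℝ, (h : EReal) < pmfHamiltonianLsc a m x ∧
      (L₂ : EReal) < idealRate d β 0 x ∧ L < β * h + L₂ := by
    have hI := idealRate_nonneg d β 0 x
    have hH := pmfHamiltonianLsc_ge ha m x
    rw [pmfFunctional] at hL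
    generalize idealRate d β 0 x = I at hI hL
    generalize pmfHamiltonianLsc a m x = H at hH hL
    have hI1 : ((-1 : ℝ) : EReal) < I := lt_of_lt_of_le (by exact_mod_cast neg_one_lt_zero) hI
    induction H with
    | bot => simp at hH
    | top =>
      refine ⟨(L + 2) / β, -1, EReal.coe_lt_top _, hI1, ?_⟩
      rw [mul_div_cancel₀ _ hβ.ne']
      linarith
    | coe H =>
      obtain ⟨L₂, hL₂, h2⟩ : ∃ L₂ : ℝ, (L₂ : EReal) < I ∧ L < β * H + L₂ := by
        induction I with
        | bot => simp at hI
        | top => exact ⟨L - β * H + 1, EReal.coe_lt_top _, by linarith⟩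
        | coe I =>
          rw [← EReal.coe_mul, ← EReal.coe_add, EReal.coe_lt_coe_iff] at hL
          obtain ⟨L₂, h1, h2⟩ := exists_between (show L - β * H < I by linarith)
          exact ⟨L₂, EReal.coe_lt_coe_iff.2 h2, by linarith⟩
      obtain ⟨h, h1, h3⟩ := exists_between (show (L - L₂) / β < H by
        rw [div_lt_iff₀ hβ]; linarith)
      rw [div_lt_iff₀ hβ] at h1
      exact ⟨h, L₂, EReal.coe_lt_coe_iff.2 h3, hL₂, by linarith⟩
  obtain ⟨S, t, ht⟩ := exists_lt_of_lt_idealRate d hβ hL₂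
  rw [Finset.sum_sub_distrib] at ht
  set Λ := ∑ k ∈ S, cycleWeight d β 0 k * (Real.exp (t k) - 1)
  obtain ⟨b, hb1, hb2⟩ := exists_between (show L - β * h + Λ < ∑ k ∈ S, t k * x k by linarith)
  have hcont : Continuous fun y : EllOne => ∑ k ∈ S, t k * y k :=
    continuous_finsetSum _ fun k _ => (EllOne.continuous_coord k).const_mul _
  refine ⟨{y | (h : EReal) < pmfHamiltonianLsc a m y} ∩ {y | b < ∑ k ∈ S, t k * y k}, h, b, S, t,
    ((lowerSemicontinuous_lscRegularisation _).isOpen_preimage (h : EReal)).inter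
      (isOpen_lt continuous_const hcont), ⟨hh, hb2⟩, ?_, ?_, by linarith⟩
  · exact fun y hy => (le_of_lt hy.1).trans (lscRegularisation_le _ y)
  · exact fun y hy => le_of_lt hy.2

/-! ### Approximation by finitely supported sequences -/

/-- Cycles of length `n → ∞` carry a fixed density `ρ` at vanishing entropic cost. -/
lemma tendsto_long_cycle_cost (d : ℕ) {β : ℝ} (hβ : 0 < β) {ρ : ℝ} (hρ : 0 ≤ ρ) :
    Tendsto (fun n : ℕ+ => ρ / n * Real.log (ρ / n / cycleWeight d β 0 n) - ρ / n) atTop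
      (𝓝 0) := by
  rcases hρ.eq_or_lt with rfl | hρ
  · simp
  have hpi := Real.pi_pos
  have hinv : Tendsto (fun n : ℕ+ => ρ / (n : ℝ)) atTop (𝓝 0) :=
    tendsto_const_nhds.div_atTop tendsto_pnat_cast_atTop
  have hlog : Tendsto (fun n : ℕ+ => Real.log (n : ℝ) / (n : ℝ)) atTop (𝓝 0) :=
    (Real.isLittleO_log_id_atTop.tendsto_div_nhds_zero).comp tendsto_pnat_cast_atTop
  have h := ((hinv.mul_const (Real.log (ρ * (4 * Real.pi * β) ^ ((d : ℝ) / 2)))).add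
    ((hlog.const_mul (ρ * ((d : ℝ) / 2))))).sub hinv
  simp only [zero_mul, mul_zero, add_zero, sub_zero] at h
  refine h.congr fun n => ?_
  have hn : 0 < (n : ℝ) := by exact_mod_cast n.pos
  have h1 : ρ / n / cycleWeight d β 0 n
      = ρ * (4 * Real.pi * β) ^ ((d : ℝ) / 2) * (n : ℝ) ^ ((d : ℝ) / 2) := by
    rw [cycleWeight, Real.rpow_add hn, Real.rpow_one]
    simp
    field_simp
  rw [h1, Real.log_mul (x := ρ * _) (by positivity) (by positivity), Real.log_rpow hn]
  ring

lemma exists_finite_support_of_pmfFunctional_lt {d : ℕ} (hd : 1 ≤ d) {β a : ℝ} (hβ : 0 < β)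
    (ha : 0 < a) {m : ℝ} {x : EllOne} {G : Set EllOne} (hG : IsOpen G) (hx : x ∈ G) {L : ℝ}
    (hL : pmfFunctional d β a m x < L) :
    ∃ y ∈ G, y ∈ ellOneNonneg ∧ ∃ S : Finset ℕ+, (∀ k ∉ S, y k = 0) ∧
      β * (-m * (∑ k ∈ S, k * y k) + a / 2 * (∑ k ∈ S, k * y k) ^ 2)
        + ∑ k ∈ S, (y k * Real.log (y k / cycleWeight d β 0 k) - y k)
        + ∑' k, cycleWeight d β 0 k < L := by
  have hq := fun k => cycleWeight_pos d hβ 0 k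
  have hQ := summable_cycleWeight_zero hd β
  have hx0 : x ∈ ellOneNonneg := by
    by_contra h
    rw [pmfFunctional, idealRate, if_neg h, EReal.add_top_of_ne_bot (ne_bot_of_le_ne_bot
      (EReal.coe_ne_bot _) (coe_mul_pmfHamiltonianLsc_ge hβ ha m x))] at hL
    exact not_top_lt hL
  rw [pmfFunctional, pmfHamiltonianLsc_eq ha, if_pos hx0, idealRate, if_pos hx0] at hL
  have hD : density x ≠ ∞ := by
    intro h
    rw [meanFieldEnvelope, if_pos h, EReal.coe_mul_top_of_pos hβ,
      EReal.top_add_of_ne_bot (by simp)] at hL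
    exact not_top_lt hL
  rw [meanFieldEnvelope_eq_energy ha m hD] at hL
  have hf := fun k => mul_log_div_sub_add_nonneg (hq k) (hx0 k)
  set f : ℕ+ → ℝ := fun k =>
    x k * Real.log (x k / cycleWeight d β 0 k) - x k + cycleWeight d β 0 k with hfdef
  have hT : ∑' k, ENNReal.ofReal (f k) ≠ ∞ := by
    intro h
    rw [h, ← EReal.coe_mul, EReal.coe_ennreal_top, EReal.coe_add_top] at hL
    exact not_top_lt hL
  have hfs : Summable f := by
    refine (ENNReal.summable_toReal hT).congr fun k => ENNReal.toReal_ofReal (hf k)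
  rw [← ENNReal.ofReal_tsum_of_nonneg hf hfs, EReal.coe_ennreal_ofReal,
    max_eq_left (tsum_nonneg hf), ← EReal.coe_mul, ← EReal.coe_add, EReal.coe_lt_coe_iff] at hL
  have hρ : 0 ≤ max (m / a - (density x).toReal) 0 := le_max_right _ _
  set ρ := max (m / a - (density x).toReal) 0 with hρdef
  have hmax : max (density x).toReal (m / a) = (density x).toReal + ρ := by
    rw [hρdef, ← max_add_add_left, max_comm]; simp
  rw [hmax] at hL
  have hE := (((continuous_const.mul continuous_id).add (continuous_const.mul
    (continuous_id.pow 2)) : Continuous fun D : ℝ => -m * D + a / 2 * D ^ 2).tendsto _).comp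
    (tendsto_sum_truncateAddMass hx0 hD ρ)
  have hsum : ∀ n : ℕ+, ∑ k ∈ Finset.Icc 1 n, (truncateAddMass x ρ n k *
        Real.log (truncateAddMass x ρ n k / cycleWeight d β 0 k) - truncateAddMass x ρ n k)
      = ∑ k ∈ Finset.Ico 1 n, (f k - cycleWeight d β 0 k)
        + (ρ / n * Real.log (ρ / n / cycleWeight d β 0 n) - ρ / n) := by
    intro n
    rw [← Finset.Ico_insert_right one_le, Finset.sum_insert (by simp), add_comm]
    congr 1
    · refine Finset.sum_congr rfl fun k hk => ?_
      rw [truncateAddMass_apply, if_pos (Finset.mem_Ico.1 hk).2]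
      simp [hfdef]
    · rw [truncateAddMass_apply, if_neg (lt_irrefl _), if_pos rfl]
  have hI : Tendsto (fun n : ℕ+ => ∑ k ∈ Finset.Icc 1 n, (truncateAddMass x ρ n k *
      Real.log (truncateAddMass x ρ n k / cycleWeight d β 0 k) - truncateAddMass x ρ n k)) atTop
      (𝓝 (∑' k, f k - ∑' k, cycleWeight d β 0 k + 0)) := by
    simp_rw [hsum]
    exact (((hfs.hasSum.sub hQ.hasSum).comp tendsto_Ico_one_atTop)).add
      (tendsto_long_cycle_cost d hβ hρ)
  have htot := ((hE.const_mul β).add hI).add_const (∑' k, cycleWeight d β 0 k)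
  have hlt : β * (-m * ((density x).toReal + ρ) + a / 2 * ((density x).toReal + ρ) ^ 2)
      + (∑' k, f k - ∑' k, cycleWeight d β 0 k + 0) + ∑' k, cycleWeight d β 0 k < L := by
    linarith
  obtain ⟨n, hn1, hn2⟩ := ((htot.eventually_lt_const hlt).and
    ((tendsto_truncateAddMass x ρ).eventually (hG.mem_nhds hx))).exists
  exact ⟨_, hn2, truncateAddMass_nonneg hx0 hρ n, Finset.Icc 1 n,
    fun k hk => truncateAddMass_eq_zero x ρ n hk, hn1⟩

/-! ### The law of the cycle numbers -/

lemma summable_bcCycleWeight_zero {d : ℕ} (hd : 1 ≤ d) (bc : BoundaryCondition) {β : ℝ}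
    (hβ : 0 < β) {N : ℕ} (hN : 1 ≤ N) : Summable fun k => bcCycleWeight d N bc β 0 k := by
  obtain ⟨C, _, hC⟩ := exists_bcCycleWeight_le d bc hβ
  exact ((summable_cycleWeight_zero hd β).mul_left C).of_nonneg_of_le
    (fun k => bcCycleWeight_nonneg d N bc hβ 0 k) fun k => hC N hN k

lemma bcCycleWeight_le_zero (d N : ℕ) (bc : BoundaryCondition) {β α : ℝ} (hβ : 0 < β)
    (hα : α ≤ 0) (k : ℕ+) : bcCycleWeight d N bc β α k ≤ bcCycleWeight d N bc β 0 k := by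
  rw [bcCycleWeight_eq_exp_mul]
  refine mul_le_of_le_one_left (bcCycleWeight_nonneg d N bc hβ 0 k) (Real.exp_le_one_iff.2 ?_)
  exact mul_nonpos_of_nonpos_of_nonneg (mul_nonpos_of_nonneg_of_nonpos hβ.le hα)
    (Nat.cast_nonneg _)

lemma summable_bcCycleWeight {d : ℕ} (hd : 1 ≤ d) (bc : BoundaryCondition) {β α : ℝ}
    (hβ : 0 < β) (hα : α ≤ 0) {N : ℕ} (hN : 1 ≤ N) :
    Summable fun k => bcCycleWeight d N bc β α k :=
  (summable_bcCycleWeight_zero hd bc hβ hN).of_nonneg_of_le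
    (fun k => bcCycleWeight_nonneg d N bc hβ α k) fun k => bcCycleWeight_le_zero d N bc hβ hα k

lemma tendsto_tsum_bcCycleWeight_zero {d : ℕ} (hd : 1 ≤ d) (bc : BoundaryCondition) {β : ℝ}
    (hβ : 0 < β) : Tendsto (fun N => ∑' k, bcCycleWeight d N bc β 0 k) atTop
      (𝓝 (∑' k, cycleWeight d β 0 k)) := by
  obtain ⟨C, _, hC⟩ := exists_bcCycleWeight_le d bc hβ
  refine tendsto_tsum_of_dominated_convergence ((summable_cycleWeight_zero hd β).mul_left C)
    (fun k => tendsto_bcCycleWeight d bc hβ k) ?_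
  filter_upwards [eventually_ge_atTop 1] with N hN k
  rw [Real.norm_of_nonneg (bcCycleWeight_nonneg d N bc hβ 0 k)]
  exact hC N hN k

lemma coe_toNNReal_boxVolume_mul (d N : ℕ) (bc : BoundaryCondition) {β : ℝ} (hβ : 0 < β)
    (α : ℝ) (k : ℕ+) : ((Real.toNNReal (boxVolume d N * bcCycleWeight d N bc β α k) : ℝ≥0) : ℝ)
      = boxVolume d N * bcCycleWeight d N bc β α k :=
  Real.coe_toNNReal _ (mul_nonneg (boxVolume_nonneg d N) (bcCycleWeight_nonneg d N bc hβ α k))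

lemma summable_toNNReal_boxVolume_mul {d : ℕ} (hd : 1 ≤ d) (bc : BoundaryCondition) {β α : ℝ}
    (hβ : 0 < β) (hα : α ≤ 0) {N : ℕ} (hN : 1 ≤ N) :
    Summable fun k => Real.toNNReal (boxVolume d N * bcCycleWeight d N bc β α k) := by
  rw [← NNReal.summable_coe]
  simp_rw [coe_toNNReal_boxVolume_mul d N bc hβ]
  exact (summable_bcCycleWeight hd bc hβ hα hN).mul_left _

lemma ae_finite_support_cycleNumberLaw {d : ℕ} (hd : 1 ≤ d) (bc : BoundaryCondition) {β α : ℝ}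
    (hβ : 0 < β) (hα : α ≤ 0) {N : ℕ} (hN : 1 ≤ N) :
    ∀ᵐ n ∂(cycleNumberLaw d N bc β α), (Function.support n).Finite :=
  ae_finite_support_infinitePi_poissonMeasure (summable_toNNReal_boxVolume_mul hd bc hβ hα hN)

instance (d N : ℕ) (bc : BoundaryCondition) (β α : ℝ) :
    IsProbabilityMeasure (cycleNumberLaw d N bc β α) := by
  unfold cycleNumberLaw
  infer_instance

lemma empiricalCycleCount_apply (d N : ℕ) {n : ℕ+ → ℕ} (hn : (Function.support n).Finite)
    (k : ℕ+) : empiricalCycleCount d N n k = (n k : ℝ) / boxVolume d N := by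
  have h : Memℓp (fun k : ℕ+ => (n k : ℝ) / boxVolume d N) 1 := by
    refine memℓp_one_iff.2 (summable_of_hasFiniteSupport (hn.subset fun k hk h => hk ?_))
    have : n k = 0 := h
    simp [this]
  rw [empiricalCycleCount, dif_pos h]

lemma empiricalCycleCount_mem (d N : ℕ) {n : ℕ+ → ℕ} (hn : (Function.support n).Finite) :
    empiricalCycleCount d N n ∈ ellOneNonneg := fun k => by
  rw [empiricalCycleCount_apply d N hn]
  exact div_nonneg (Nat.cast_nonneg _) (boxVolume_nonneg d N)

lemma density_empiricalCycleCount (d N : ℕ) {n : ℕ+ → ℕ} (hn : (Function.support n).Finite) :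
    density (empiricalCycleCount d N n)
      = ENNReal.ofReal ((∑' k : ℕ+, (k : ℝ) * n k) / boxVolume d N) := by
  rw [density_eq_sum (empiricalCycleCount_mem d N hn) hn.toFinset, tsum_eq_sum (s := hn.toFinset),
    Finset.sum_div]
  · simp_rw [empiricalCycleCount_apply d N hn, mul_div_assoc]
  · intro k hk
    simp only [Set.Finite.mem_toFinset, Function.mem_support, not_not] at hk
    simp [hk]
  · intro k hk
    simp only [Set.Finite.mem_toFinset, Function.mem_support, not_not] at hk
    simp [empiricalCycleCount_apply d N hn, hk]

lemma pmfHamiltonian_empiricalCycleCount (d N : ℕ) (a m : ℝ) {n : ℕ+ → ℕ}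
    (hn : (Function.support n).Finite) :
    pmfHamiltonian a m (empiricalCycleCount d N n)
      = ((-m * ((∑' k : ℕ+, (k : ℝ) * n k) / boxVolume d N)
        + a / 2 * ((∑' k : ℕ+, (k : ℝ) * n k) / boxVolume d N) ^ 2 : ℝ) : EReal) := by
  have hd := density_empiricalCycleCount d N hn
  rw [pmfHamiltonian_eq_of_ne_top (empiricalCycleCount_mem d N hn) a m
    (by rw [hd]; exact ENNReal.ofReal_ne_top), hd, ENNReal.toReal_ofReal]
  exact div_nonneg (tsum_nonneg fun k => by positivity) (boxVolume_nonneg d N)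

lemma countable_setOf_finite_support : {n : ℕ+ → ℕ | (Function.support n).Finite}.Countable := by
  have h : {n : ℕ+ → ℕ | (Function.support n).Finite} ⊆
      Set.range (fun f : ℕ+ →₀ ℕ => (f : ℕ+ → ℕ)) := by
    intro n hn
    exact ⟨Finsupp.ofSupportFinite n hn, rfl⟩
  exact (Set.countable_range _).mono h

/-- The cycle numbers live on the countable set of finitely supported sequences, on which every
function is measurable. -/
lemma aemeasurable_empiricalCycleCount {d : ℕ} (hd : 1 ≤ d) (bc : BoundaryCondition) {β α : ℝ}
    (hβ : 0 < β) (hα : α ≤ 0) {N : ℕ} (hN : 1 ≤ N) :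
    AEMeasurable (empiricalCycleCount d N) (cycleNumberLaw d N bc β α) := by
  classical
  have hc := countable_setOf_finite_support
  refine ⟨fun n => if (Function.support n).Finite then empiricalCycleCount d N n else 0, ?_, ?_⟩
  · refine measurable_of_restrict_of_restrict_compl hc.measurableSet ?_ ?_
    · have := hc.to_subtype
      exact measurable_of_countable _
    · convert measurable_const (a := (0 : EllOne)) with n
      exact if_neg n.2
  · filter_upwards [ae_finite_support_cycleNumberLaw hd bc hβ hα hN] with n hn
    rw [if_pos hn]

/-! ### The unnormalised measure -/

lemma measurable_meanFieldEnergy (a m : ℝ) : Measurable (meanFieldEnergy a m) := by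
  refine Measurable.ite (measurableSet_singleton _) measurable_const ?_
  exact measurable_coe_real_ereal.comp (by fun_prop)

lemma measurable_pmfHamiltonian (a m : ℝ) : Measurable (pmfHamiltonian a m) := by
  classical
  refine Measurable.ite isClosed_ellOneNonneg.measurableSet ?_ measurable_const
  exact (measurable_meanFieldEnergy a m).comp lowerSemicontinuous_density.measurable

lemma measurable_pmfBoltzmann (d : ℕ) (β a μ : ℝ) (N : ℕ) :
    Measurable (pmfBoltzmann d β a μ N) :=
  ((measurable_pmfHamiltonian a μ).const_mul _).ereal_exp

/-- The measure `e^{-|Λ_N| β H_μ} dν_{N,α}` before normalisation. -/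
noncomputable def pmfUnnormalised (d : ℕ) (bc : BoundaryCondition) (β a μ α : ℝ) (N : ℕ) :
    Measure EllOne :=
  (idealMeasure d bc β α N).withDensity (pmfBoltzmann d β a μ N)

lemma pmfMeasure_eq_smul (d : ℕ) (bc : BoundaryCondition) (β a μ α : ℝ) (N : ℕ) :
    pmfMeasure d bc β a μ α N
      = (pmfPartition d bc β a μ α N)⁻¹ • pmfUnnormalised d bc β a μ α N := by
  rw [pmfMeasure, pmfUnnormalised, ← withDensity_smul _ (measurable_pmfBoltzmann d β a μ N)]
  congr 1
  ext x
  simp [div_eq_mul_inv, mul_comm]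

lemma pmfPartition_eq (d : ℕ) (bc : BoundaryCondition) (β a μ α : ℝ) (N : ℕ) :
    pmfPartition d bc β a μ α N = pmfUnnormalised d bc β a μ α N Set.univ := by
  rw [pmfUnnormalised, withDensity_apply _ MeasurableSet.univ, Measure.restrict_univ,
    pmfPartition]

lemma pmfUnnormalised_apply {d : ℕ} (hd : 1 ≤ d) (bc : BoundaryCondition) {β α : ℝ}
    (hβ : 0 < β) (a μ : ℝ) (hα : α ≤ 0) {N : ℕ} (hN : 1 ≤ N) {A : Set EllOne}
    (hA : MeasurableSet A) :
    pmfUnnormalised d bc β a μ α N A = ∫⁻ n, A.indicator (pmfBoltzmann d β a μ N)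
      (empiricalCycleCount d N n) ∂(cycleNumberLaw d N bc β α) := by
  rw [pmfUnnormalised, withDensity_apply _ hA, ← lintegral_indicator hA, idealMeasure,
    lintegral_map' ((measurable_pmfBoltzmann d β a μ N).indicator hA).aemeasurable
      (aemeasurable_empiricalCycleCount hd bc hβ hα hN)]

lemma pmfBoltzmann_empiricalCycleCount {d N : ℕ} (hN : 1 ≤ N) (β a μ α : ℝ) {n : ℕ+ → ℕ}
    (hn : (Function.support n).Finite) :
    pmfBoltzmann d β a μ N (empiricalCycleCount d N n) = ENNReal.ofReal (Real.exp
      (-(boxVolume d N * (β * (-(μ + α) * ((∑' k : ℕ+, (k : ℝ) * n k) / boxVolume d N)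
        + a / 2 * ((∑' k : ℕ+, (k : ℝ) * n k) / boxVolume d N) ^ 2)))
        - β * α * ∑' k : ℕ+, (k : ℝ) * n k)) := by
  have hV := boxVolume_pos d hN
  rw [pmfBoltzmann, pmfHamiltonian_empiricalCycleCount d N a μ hn, ← EReal.coe_mul,
    EReal.exp_coe]
  congr 2
  field_simp
  ring

/-- The difference `∑_k q_k^{(bc,0)} - ∑_k q_k^{(bc,α)}` of the total masses, which is the cost per
volume of replacing the fugacity parameter `0` by `α`. -/
noncomputable def massShift (d : ℕ) (bc : BoundaryCondition) (β α : ℝ) (N : ℕ) : ℝ :=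
  ∑' k, bcCycleWeight d N bc β 0 k - ∑' k, bcCycleWeight d N bc β α k

/-! ### The upper bound -/

/-- Exponential Chebyshev inequality. The tilt `e^{βαk}` of the cycle weights is absorbed into the
exponential moment, which turns the chemical potential `μ` into `μ + α`. -/
lemma pmfUnnormalised_le {d : ℕ} (hd : 1 ≤ d) (bc : BoundaryCondition) {β α : ℝ}
    (hβ : 0 < β) (a μ : ℝ) (hα : α ≤ 0) {N : ℕ} (hN : 1 ≤ N) {A : Set EllOne}
    (hA : MeasurableSet A) {h b : ℝ} {t : ℕ+ → ℝ}
    (hh : ∀ y ∈ A, (h : EReal) ≤ pmfHamiltonian a (μ + α) y)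
    (hb : ∀ y ∈ A, b ≤ ∑' k, t k * y k)
    (ht : Summable fun k => bcCycleWeight d N bc β 0 k * Real.exp (t k)) :
    pmfUnnormalised d bc β a μ α N A ≤ ENNReal.ofReal (Real.exp (boxVolume d N *
      (massShift d bc β α N - (β * h + b
        - ∑' k, bcCycleWeight d N bc β 0 k * (Real.exp (t k) - 1))))) := by
  have hV := boxVolume_pos d hN
  have hq0 := summable_bcCycleWeight_zero hd bc hβ hN
  have hqα := summable_bcCycleWeight hd bc hβ hα hN
  rw [pmfUnnormalised_apply hd bc hβ a μ hα hN hA]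
  -- the exponents after absorbing the tilt
  set s : ℕ+ → ℝ := fun k => t k - β * α * k with hs
  have hexp : ∀ k, bcCycleWeight d N bc β α k * Real.exp (s k)
      = bcCycleWeight d N bc β 0 k * Real.exp (t k) := by
    intro k
    rw [bcCycleWeight_eq_exp_mul d N bc β α, hs, Real.exp_sub]
    field_simp
  have hpt : ∀ᵐ n ∂(cycleNumberLaw d N bc β α), A.indicator (pmfBoltzmann d β a μ N)
      (empiricalCycleCount d N n) ≤ ENNReal.ofReal (Real.exp (-(boxVolume d N * (β * h + b)))) *
        ENNReal.ofReal (Real.exp (∑' k, s k * n k)) := by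
    filter_upwards [ae_finite_support_cycleNumberLaw hd bc hβ hα hN] with n hn
    by_cases hnA : empiricalCycleCount d N n ∈ A
    swap
    · rw [Set.indicator_of_notMem hnA]
      exact zero_le
    have hsm : ∀ g : ℕ+ → ℝ, Summable fun k => g k * (n k : ℝ) := fun g => by
      refine summable_of_hasFiniteSupport (hn.subset fun k hk h => hk ?_)
      have : n k = 0 := h
      simp [this]
    have h1 := hh _ hnA
    have h2 := hb _ hnA
    rw [pmfHamiltonian_empiricalCycleCount d N a _ hn, EReal.coe_le_coe_iff] at h1
    simp_rw [empiricalCycleCount_apply d N hn, ← mul_div_assoc] at h2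
    rw [tsum_div_const, le_div_iff₀ hV] at h2
    rw [Set.indicator_of_mem hnA, pmfBoltzmann_empiricalCycleCount hN β a μ α hn,
      ← ENNReal.ofReal_mul (Real.exp_pos _).le, ← Real.exp_add]
    refine ENNReal.ofReal_le_ofReal (Real.exp_le_exp.2 ?_)
    have h3 : ∑' k, s k * n k = ∑' k, t k * n k - β * α * ∑' k : ℕ+, (k : ℝ) * n k := by
      rw [← tsum_mul_left, ← (hsm t).tsum_sub ((hsm fun k => (k : ℝ)).mul_left _)]
      exact tsum_congr fun k => by rw [hs]; ring
    rw [h3]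
    have h4 := mul_le_mul_of_nonneg_left (mul_le_mul_of_nonneg_left h1 hβ.le) hV.le
    linarith
  refine (lintegral_mono_ae hpt).trans ?_
  rw [lintegral_const_mul' _ _ ENNReal.ofReal_ne_top]
  have hmgf := lintegral_exp_tsum_infinitePi_poissonMeasure_le
    (summable_toNNReal_boxVolume_mul hd bc hβ hα hN) s (by
      simp_rw [coe_toNNReal_boxVolume_mul d N bc hβ, mul_assoc, hexp]
      exact ht.mul_left _)
  refine (mul_le_mul_right hmgf _).trans_eq ?_
  rw [← ENNReal.ofReal_mul (Real.exp_pos _).le, ← Real.exp_add]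
  congr 2
  simp_rw [coe_toNNReal_boxVolume_mul d N bc hβ, mul_assoc, mul_sub, hexp, mul_one]
  rw [(ht.mul_left _).tsum_sub (hqα.mul_left _), ht.tsum_sub hq0, tsum_mul_left, tsum_mul_left,
    massShift]
  ring

/-! ### Exponential tightness -/

lemma EllOne.continuous_tsum_mul {t : ℕ+ → ℝ} (ht : ∀ k, |t k| ≤ 1) :
    Continuous fun y : EllOne => ∑' k, t k * y k := by
  have hle : ∀ (y : EllOne) k, ‖t k * y k‖ ≤ |y k| := fun y k => by
    rw [Real.norm_eq_abs, abs_mul]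
    exact mul_le_of_le_one_left (abs_nonneg _) (ht k)
  have hs : ∀ y : EllOne, Summable fun k => t k * y k := fun y =>
    Summable.of_norm_bounded y.summable_abs (hle y)
  refine LipschitzWith.continuous (K := 1) (LipschitzWith.of_dist_le_mul fun y z => ?_)
  rw [NNReal.coe_one, one_mul, dist_eq_norm, dist_eq_norm, EllOne.norm_eq,
    ← (hs y).tsum_sub (hs z)]
  refine tsum_of_norm_bounded (y - z).summable_abs.hasSum fun k => ?_
  rw [← mul_sub]
  exact hle (y - z) k

/-- The mass `∑_{k ∉ S} y_k` outside of the finite set `S`. -/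
noncomputable def tailMass (S : Finset ℕ+) (y : EllOne) : ℝ :=
  ∑' k, (if k ∈ S then 0 else 1) * y k

lemma continuous_tailMass (S : Finset ℕ+) : Continuous (tailMass S) :=
  EllOne.continuous_tsum_mul fun k => by split_ifs <;> simp

lemma summable_tailMass (S : Finset ℕ+) (y : EllOne) :
    Summable fun k => (if k ∈ S then 0 else 1) * y k := by
  refine Summable.of_norm_bounded y.summable_abs fun k => ?_
  split_ifs <;> simp

lemma coord_le_tailMass_empty {y : EllOne} (hy : y ∈ ellOneNonneg) (k : ℕ+) :
    y k ≤ tailMass ∅ y := by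
  have h := y.summable.le_tsum k fun j _ => hy j
  simpa [tailMass] using h

lemma norm_sub_le_of_close {S : Finset ℕ+} {y z : EllOne} (hy : y ∈ ellOneNonneg)
    (hz : z ∈ ellOneNonneg) {c : ℝ} (hc : ∀ k ∈ S, |y k - z k| ≤ c) :
    ‖y - z‖ ≤ S.card * c + tailMass S y + tailMass S z := by
  have h1 : HasSum (fun k => if k ∈ S then c else 0) (S.card * c) := by
    have : HasSum (fun k => if k ∈ S then c else 0) (∑ k ∈ S, if k ∈ S then c else 0) :=
      hasSum_sum_of_ne_finset_zero fun k hk => if_neg hk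
    rwa [Finset.sum_congr rfl fun k hk => if_pos hk, Finset.sum_const, nsmul_eq_mul] at this
  have h2 := (h1.add (summable_tailMass S y).hasSum).add (summable_tailMass S z).hasSum
  rw [EllOne.norm_eq, tailMass, tailMass, ← h2.tsum_eq]
  refine (y - z).summable_abs.tsum_le_tsum (fun k => ?_) h2.summable
  rw [lp.coeFn_sub, Pi.sub_apply]
  split_ifs with hk
  · simpa using hc k hk
  · rw [zero_add, one_mul, one_mul]
    exact (abs_sub _ _).trans_eq (by rw [abs_of_nonneg (hy k), abs_of_nonneg (hz k)])

/-- Bounded sets of nonnegative sequences with uniformly small tails are compact in `ℓ₁`. -/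
lemma isCompact_of_tailMass_le (R : ℝ) (S : ℕ → Finset ℕ+) :
    IsCompact {y : EllOne | y ∈ ellOneNonneg ∧ tailMass ∅ y ≤ R ∧
      ∀ j : ℕ, tailMass (S j) y ≤ 1 / ((j : ℝ) + 1)} := by
  refine TotallyBounded.isCompact_of_isClosed ?_ ?_
  · refine Metric.totallyBounded_of_finite_discretization fun ε hε => ?_
    obtain ⟨j, hj⟩ := exists_nat_one_div_lt (show 0 < ε / 4 by positivity)
    -- the mesh of the discretisation on the coordinates in `S j`
    set c : ℝ := ε / (4 * ((S j).card + 1)) with hc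
    have hc0 : 0 < c := by positivity
    have hcard : (S j).card * c ≤ ε / 4 := by
      rw [hc, mul_div_assoc', div_le_div_iff₀ (by positivity) (by positivity)]
      nlinarith
    set M : ℕ := ⌊R / c⌋₊ with hM
    refine ⟨S j → Fin (M + 1), inferInstance,
      fun y k => ⟨min ⌊y.1 k / c⌋₊ M, by omega⟩, fun y z hyz => ?_⟩
    obtain ⟨y, hy0, hyR, hyt⟩ := y
    obtain ⟨z, hz0, hzR, hzt⟩ := z
    have hclose : ∀ k ∈ S j, |y k - z k| ≤ c := by
      intro k hk
      have h := congrArg Fin.val (congrFun hyz ⟨k, hk⟩)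
      have hyM : ⌊y k / c⌋₊ ≤ M :=
        Nat.floor_le_floor (by gcongr; exact (coord_le_tailMass_empty hy0 k).trans hyR)
      have hzM : ⌊z k / c⌋₊ ≤ M :=
        Nat.floor_le_floor (by gcongr; exact (coord_le_tailMass_empty hz0 k).trans hzR)
      simp only [min_eq_left hyM, min_eq_left hzM] at h
      have h1 := Nat.floor_le (div_nonneg (hy0 k) hc0.le)
      have h2 := Nat.lt_floor_add_one (y k / c)
      have h3 := Nat.floor_le (div_nonneg (hz0 k) hc0.le)
      have h4 := Nat.lt_floor_add_one (z k / c)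
      rw [h] at h1 h2
      have h5 : |y k / c - z k / c| ≤ 1 := by
        rw [abs_le]; constructor <;> linarith
      rwa [← sub_div, abs_div, abs_of_pos hc0, div_le_one hc0] at h5
    have h := norm_sub_le_of_close hy0 hz0 hclose
    have h1 := hyt j
    have h2 := hzt j
    show dist y z < ε
    rw [dist_eq_norm]
    linarith
  · have : {y : EllOne | ∀ j : ℕ, tailMass (S j) y ≤ 1 / ((j : ℝ) + 1)}
        = ⋂ j : ℕ, {y | tailMass (S j) y ≤ 1 / ((j : ℝ) + 1)} := by ext; simp
    have htails : IsClosed {y : EllOne | ∀ j : ℕ, tailMass (S j) y ≤ 1 / ((j : ℝ) + 1)} := by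
      rw [this]
      exact isClosed_iInter fun j => isClosed_le (continuous_tailMass _) continuous_const
    exact isClosed_ellOneNonneg.inter
      ((isClosed_le (continuous_tailMass ∅) continuous_const).inter htails)

lemma pmfHamiltonian_ge {a : ℝ} (ha : 0 < a) (m : ℝ) (y : EllOne) :
    ((-(m ^ 2 / (2 * a)) : ℝ) : EReal) ≤ pmfHamiltonian a m y :=
  (pmfHamiltonianLsc_ge ha m y).trans (lscRegularisation_le _ y)

lemma pmfUnnormalised_tail_le {d : ℕ} (hd : 1 ≤ d) (bc : BoundaryCondition) {β α a C : ℝ}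
    (hβ : 0 < β) (ha : 0 < a) (μ : ℝ) (hα : α ≤ 0)
    (hC : ∀ N : ℕ, 1 ≤ N → ∀ k, bcCycleWeight d N bc β 0 k ≤ C * cycleWeight d β 0 k)
    {N : ℕ} (hN : 1 ≤ N) (S : Finset ℕ+) {ε l : ℝ} (hl : 0 ≤ l) :
    pmfUnnormalised d bc β a μ α N {y | ε < tailMass S y} ≤ ENNReal.ofReal (Real.exp
      (boxVolume d N * (massShift d bc β α N - (β * -((μ + α) ^ 2 / (2 * a)) + l * ε
        - C * (Real.exp l - 1) * ∑' k : ↥((S : Set ℕ+)ᶜ), cycleWeight d β 0 k)))) := by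
  have hq0 := summable_bcCycleWeight_zero hd bc hβ hN
  have hQ := summable_cycleWeight_zero hd β
  have hnn := fun k => bcCycleWeight_nonneg d N bc hβ 0 k
  have hexp : 1 ≤ Real.exp l := Real.one_le_exp hl
  set t : ℕ+ → ℝ := fun k => l * (if k ∈ S then 0 else 1) with ht
  have h1 : ∀ k, bcCycleWeight d N bc β 0 k * (Real.exp (t k) - 1)
      ≤ C * (Real.exp l - 1) * ((S : Set ℕ+)ᶜ).indicator (fun k => cycleWeight d β 0 k) k := by
    intro k
    by_cases hk : k ∈ S
    · simp [ht, hk]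
    · rw [Set.indicator_of_mem (by simpa using hk)]
      simp only [ht, if_neg hk, mul_one]
      have := mul_le_mul_of_nonneg_right (hC N hN k) (sub_nonneg.2 hexp)
      linarith
  have hts : Summable fun k => bcCycleWeight d N bc β 0 k * Real.exp (t k) := by
    refine (hq0.mul_right (Real.exp l)).of_nonneg_of_le
      (fun k => mul_nonneg (hnn k) (Real.exp_pos _).le) fun k => ?_
    refine mul_le_mul_of_nonneg_left (Real.exp_le_exp.2 ?_) (hnn k)
    simp only [ht]
    split_ifs <;> linarith
  have hts' : Summable fun k => bcCycleWeight d N bc β 0 k * (Real.exp (t k) - 1) := by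
    simpa only [mul_sub, mul_one] using hts.sub hq0
  refine (pmfUnnormalised_le hd bc hβ a μ hα hN
    (isOpen_lt continuous_const (continuous_tailMass S)).measurableSet
    (h := -((μ + α) ^ 2 / (2 * a))) (b := l * ε) (t := t)
    (fun y _ => pmfHamiltonian_ge ha _ y) (fun y hy => ?_) hts).trans ?_
  · simp only [ht, mul_assoc]
    rw [tsum_mul_left]
    exact mul_le_mul_of_nonneg_left (le_of_lt hy) hl
  · have h2 : ∑' k, bcCycleWeight d N bc β 0 k * (Real.exp (t k) - 1) ≤
        C * (Real.exp l - 1) * ∑' k : ↥((S : Set ℕ+)ᶜ), cycleWeight d β 0 k := by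
      rw [tsum_subtype ((S : Set ℕ+)ᶜ) fun k => cycleWeight d β 0 k, ← tsum_mul_left]
      exact hts'.tsum_le_tsum h1 ((hQ.indicator _).mul_left _)
    refine ENNReal.ofReal_le_ofReal (Real.exp_le_exp.2
      (mul_le_mul_of_nonneg_left ?_ (boxVolume_nonneg d N)))
    linarith

lemma pmfUnnormalised_compl_nonneg (d : ℕ) (bc : BoundaryCondition) {β : ℝ} (hβ : 0 < β)
    (a μ α : ℝ) {N : ℕ} (hN : 1 ≤ N) :
    pmfUnnormalised d bc β a μ α N ellOneNonnegᶜ = 0 := by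
  have hV := boxVolume_pos d hN
  rw [pmfUnnormalised, withDensity_apply _ isClosed_ellOneNonneg.measurableSet.compl]
  refine (setLIntegral_congr_fun isClosed_ellOneNonneg.measurableSet.compl fun x hx => ?_).trans
    lintegral_zero
  rw [pmfBoltzmann, pmfHamiltonian, if_neg hx,
    EReal.coe_mul_top_of_neg (by nlinarith [mul_pos hV hβ]), EReal.exp_bot]

/-- Outside of a suitable compact set of sequences with small tails the measures are exponentially
small at any prescribed rate. -/
lemma exists_isCompact_pmfUnnormalised_compl_le {d : ℕ} (hd : 1 ≤ d) (bc : BoundaryCondition)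
    {β α a : ℝ} (hβ : 0 < β) (ha : 0 < a) (μ : ℝ) (hα : α ≤ 0) (L : ℝ) :
    ∃ K : Set EllOne, IsCompact K ∧ ∀ N : ℕ, 1 ≤ N → pmfUnnormalised d bc β a μ α N Kᶜ ≤
      ENNReal.ofReal (Real.exp (boxVolume d N * (massShift d bc β α N - L))) := by
  obtain ⟨C, hC0, hC⟩ := exists_bcCycleWeight_le d bc hβ
  have hQ := summable_cycleWeight_zero hd β
  set h₀ : ℝ := β * -((μ + α) ^ 2 / (2 * a)) with hh₀
  have htail : ∀ l : ℝ, ∃ S : Finset ℕ+,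
      C * (Real.exp l - 1) * ∑' k : ↥((S : Set ℕ+)ᶜ), cycleWeight d β 0 k < 1 := by
    intro l
    have h := (tendsto_tsum_compl_atTop_zero fun k => cycleWeight d β 0 k).const_mul
      (C * (Real.exp l - 1))
    rw [mul_zero] at h
    exact (h.eventually_lt_const one_pos).exists
  -- the exponents are chosen so that the `j`-th tail has rate at least `L + j + 2`
  set l : ℕ → ℝ := fun j => (j + 1) * |L + j + 3 - h₀| with hl
  choose S hS using fun j => htail (l j)
  set R : ℝ := L + 1 - h₀
    + C * (Real.exp 1 - 1) * ∑' k : ↥(((∅ : Finset ℕ+) : Set ℕ+)ᶜ), cycleWeight d β 0 k with hR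
  refine ⟨_, isCompact_of_tailMass_le R S, fun N hN => ?_⟩
  have hV1 : 1 ≤ boxVolume d N := by
    have h := two_mul_le_boxVolume hd hN
    have : (1 : ℝ) ≤ N := by exact_mod_cast hN
    linarith
  have hV0 : 0 ≤ boxVolume d N := boxVolume_nonneg d N
  set ms := massShift d bc β α N
  have hsub : {y : EllOne | y ∈ ellOneNonneg ∧ tailMass ∅ y ≤ R ∧
      ∀ j : ℕ, tailMass (S j) y ≤ 1 / ((j : ℝ) + 1)}ᶜ ⊆ ellOneNonnegᶜ ∪
        ({y | R < tailMass ∅ y} ∪ ⋃ j : ℕ, {y | 1 / ((j : ℝ) + 1) < tailMass (S j) y}) := by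
    intro y hy
    by_contra hcon
    simp only [Set.mem_union, Set.mem_compl_iff, Set.mem_ofPred_eq, Set.mem_iUnion, not_or,
      not_not, not_lt, not_exists] at hcon
    exact hy hcon
  -- the total error `∑_j e^{-(j+1)V} ≤ 1`
  have hdecay : ∀ i : ℕ, Real.exp (boxVolume d N * (ms - (L + (i + 1))))
      ≤ Real.exp (boxVolume d N * (ms - L)) * (1 / 2) ^ (i + 1) := by
    intro i
    have h2 : Real.exp (-1) ≤ 1 / 2 := by
      rw [Real.exp_neg, one_div]
      exact inv_anti₀ two_pos (by linarith [Real.add_one_le_exp 1])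
    calc Real.exp (boxVolume d N * (ms - (L + (i + 1))))
        ≤ Real.exp (boxVolume d N * (ms - L) + (i + 1 : ℕ) * (-1)) := by
          refine Real.exp_le_exp.2 ?_
          push_cast
          nlinarith [mul_le_mul_of_nonneg_right hV1 (by positivity : (0 : ℝ) ≤ i + 1)]
      _ ≤ _ := by
          rw [Real.exp_add, Real.exp_nat_mul]
          gcongr
  have hR' : pmfUnnormalised d bc β a μ α N {y | R < tailMass ∅ y} ≤
      ENNReal.ofReal (Real.exp (boxVolume d N * (ms - L)) * (1 / 2) ^ (0 + 1)) := by
    refine (pmfUnnormalised_tail_le hd bc hβ ha μ hα hC hN ∅ zero_le_one).trans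
      (ENNReal.ofReal_le_ofReal (le_trans (Real.exp_le_exp.2
        (mul_le_mul_of_nonneg_left ?_ hV0)) (hdecay 0)))
    push_cast
    linarith
  have hj : ∀ j : ℕ, pmfUnnormalised d bc β a μ α N {y | 1 / ((j : ℝ) + 1) < tailMass (S j) y} ≤
      ENNReal.ofReal (Real.exp (boxVolume d N * (ms - L)) * (1 / 2) ^ (j + 1 + 1)) := by
    intro j
    have hl0 : 0 ≤ l j := by rw [hl]; positivity
    refine (pmfUnnormalised_tail_le hd bc hβ ha μ hα hC hN (S j) hl0).trans
      (ENNReal.ofReal_le_ofReal (le_trans (Real.exp_le_exp.2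
        (mul_le_mul_of_nonneg_left ?_ hV0)) (hdecay (j + 1))))
    have h1 : l j * (1 / ((j : ℝ) + 1)) = |L + j + 3 - h₀| := by
      rw [hl]; field_simp
    rw [h1]
    have h2 := le_abs_self (L + j + 3 - h₀)
    have h3 := hS j
    push_cast
    linarith
  have hgeom : HasSum (fun i : ℕ => Real.exp (boxVolume d N * (ms - L)) * (1 / 2) ^ (i + 1))
      (Real.exp (boxVolume d N * (ms - L))) := by
    have := (hasSum_geometric_two.mul_left (1 / 2 : ℝ)).mul_left
      (Real.exp (boxVolume d N * (ms - L)))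
    simpa [pow_succ, mul_comm] using this
  calc _ ≤ pmfUnnormalised d bc β a μ α N ellOneNonnegᶜ +
        (pmfUnnormalised d bc β a μ α N {y | R < tailMass ∅ y} + ∑' j : ℕ,
          pmfUnnormalised d bc β a μ α N {y | 1 / ((j : ℝ) + 1) < tailMass (S j) y}) := by
        refine (measure_mono hsub).trans ((measure_union_le _ _).trans ?_)
        gcongr
        refine (measure_union_le _ _).trans ?_
        gcongr
        exact measure_iUnion_le _
    _ ≤ ∑' i : ℕ, ENNReal.ofReal
          (Real.exp (boxVolume d N * (ms - L)) * (1 / 2) ^ (i + 1)) := by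
        rw [pmfUnnormalised_compl_nonneg d bc hβ a μ α hN, zero_add,
          tsum_eq_zero_add' (f := fun i : ℕ => ENNReal.ofReal
            (Real.exp (boxVolume d N * (ms - L)) * (1 / 2) ^ (i + 1))) ENNReal.summable]
        exact add_le_add hR' (ENNReal.tsum_le_tsum hj)
    _ = _ := by
        rw [← ENNReal.ofReal_tsum_of_nonneg (fun i => by positivity) hgeom.summable,
          hgeom.tsum_eq]

/-! ### Large deviation bounds for the unnormalised measures -/

lemma exists_isOpen_pmfUnnormalised_le {d : ℕ} (hd : 1 ≤ d) (bc : BoundaryCondition)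
    {β α a : ℝ} (hβ : 0 < β) (ha : 0 < a) (μ : ℝ) (hα : α ≤ 0) {x : EllOne} {L : ℝ}
    (hL : (L : EReal) < pmfFunctional d β a (μ + α) x) :
    ∃ U : Set EllOne, IsOpen U ∧ x ∈ U ∧ ∀ᶠ N in atTop, pmfUnnormalised d bc β a μ α N U ≤
      ENNReal.ofReal (Real.exp (boxVolume d N * (massShift d bc β α N - L))) := by
  obtain ⟨U, h, b, S, t, hU, hxU, hh, hb, hlt⟩ := exists_nhds_of_lt_pmfFunctional d hβ ha hL
  refine ⟨U, hU, hxU, ?_⟩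
  have hlim : Tendsto (fun N => β * h + b
      - ∑ k ∈ S, bcCycleWeight d N bc β 0 k * (Real.exp (t k) - 1)) atTop
      (𝓝 (β * h + b - ∑ k ∈ S, cycleWeight d β 0 k * (Real.exp (t k) - 1))) :=
    tendsto_const_nhds.sub (tendsto_finsetSum S fun k _ =>
      (tendsto_bcCycleWeight d bc hβ k).mul_const _)
  filter_upwards [hlim.eventually_const_lt hlt, eventually_ge_atTop 1] with N hN1 hN
  set t' : ℕ+ → ℝ := fun k => if k ∈ S then t k else 0 with ht'
  have h1 : ∀ y : EllOne, ∑' k, t' k * y k = ∑ k ∈ S, t k * y k := fun y => by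
    rw [tsum_eq_sum (s := S) fun k hk => by simp [ht', hk]]
    exact Finset.sum_congr rfl fun k hk => by simp [ht', hk]
  have h2 : ∑' k, bcCycleWeight d N bc β 0 k * (Real.exp (t' k) - 1)
      = ∑ k ∈ S, bcCycleWeight d N bc β 0 k * (Real.exp (t k) - 1) := by
    rw [tsum_eq_sum (s := S) fun k hk => by simp [ht', hk]]
    exact Finset.sum_congr rfl fun k hk => by simp [ht', hk]
  have h3 : Summable fun k => bcCycleWeight d N bc β 0 k * Real.exp (t' k) := by
    have hfin : Summable fun k => bcCycleWeight d N bc β 0 k * (Real.exp (t' k) - 1) :=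
      summable_of_ne_finset_zero (s := S) fun k hk => by simp [ht', hk]
    refine (hfin.add (summable_bcCycleWeight_zero hd bc hβ hN)).congr fun k => ?_
    ring
  refine (pmfUnnormalised_le hd bc hβ a μ hα hN hU.measurableSet hh
    (fun y hy => (hb y hy).trans_eq (h1 y).symm) h3).trans ?_
  rw [h2]
  exact ENNReal.ofReal_le_ofReal (Real.exp_le_exp.2
    (mul_le_mul_of_nonneg_left (by linarith) (boxVolume_nonneg d N)))

lemma eventually_pmfUnnormalised_le {d : ℕ} (hd : 1 ≤ d) (bc : BoundaryCondition)
    {β α a : ℝ} (hβ : 0 < β) (ha : 0 < a) (μ : ℝ) (hα : α ≤ 0) {F : Set EllOne}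
    (hF : IsClosed F) {L : ℝ} (hL : (L : EReal) < ⨅ x ∈ F, pmfFunctional d β a (μ + α) x) :
    ∀ᶠ N in atTop, pmfUnnormalised d bc β a μ α N F ≤
      ENNReal.ofReal (Real.exp (boxVolume d N * (massShift d bc β α N - L))) := by
  obtain ⟨L', hLL', hL'⟩ := EReal.lt_iff_exists_real_btwn.1 hL
  rw [EReal.coe_lt_coe_iff] at hLL'
  obtain ⟨K, hK, hKN⟩ := exists_isCompact_pmfUnnormalised_compl_le hd bc hβ ha μ hα L'
  have hcover : ∃ c : ℕ, ∀ᶠ N in atTop, pmfUnnormalised d bc β a μ α N (F ∩ K) ≤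
      c * ENNReal.ofReal (Real.exp (boxVolume d N * (massShift d bc β α N - L'))) := by
    refine (hK.inter_left hF).induction_on (p := fun s => ∃ c : ℕ, ∀ᶠ N in atTop,
      pmfUnnormalised d bc β a μ α N s ≤
        c * ENNReal.ofReal (Real.exp (boxVolume d N * (massShift d bc β α N - L')))) ?_ ?_ ?_ ?_
    · exact ⟨0, by simp⟩
    · rintro s t hst ⟨c, hc⟩
      exact ⟨c, hc.mono fun N h => (measure_mono hst).trans h⟩
    · rintro s t ⟨c, hc⟩ ⟨c', hc'⟩
      refine ⟨c + c', ?_⟩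
      filter_upwards [hc, hc'] with N h h'
      rw [Nat.cast_add, add_mul]
      exact (measure_union_le _ _).trans (add_le_add h h')
    · intro x hx
      obtain ⟨U, hU, hxU, hN⟩ := exists_isOpen_pmfUnnormalised_le hd bc hβ ha μ hα
        (hL'.trans_le (iInf₂_le x hx.1))
      exact ⟨U, mem_nhdsWithin_of_mem_nhds (hU.mem_nhds hxU), 1, by simpa using hN⟩
  obtain ⟨c, hc⟩ := hcover
  have hgrow : ∀ᶠ N in atTop, (c : ℝ) + 1 ≤ Real.exp (boxVolume d N * (L' - L)) :=
    (Real.tendsto_exp_atTop.comp ((tendsto_boxVolume hd).atTop_mul_const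
      (sub_pos.2 hLL'))).eventually_ge_atTop _
  filter_upwards [hc, hgrow, eventually_ge_atTop 1] with N h1 h2 hN
  calc pmfUnnormalised d bc β a μ α N F
      ≤ pmfUnnormalised d bc β a μ α N (F ∩ K) + pmfUnnormalised d bc β a μ α N Kᶜ := by
        refine (measure_mono fun x hx => ?_).trans (measure_union_le _ _)
        by_cases hxK : x ∈ K
        · exact .inl ⟨hx, hxK⟩
        · exact .inr hxK
    _ ≤ c * ENNReal.ofReal (Real.exp (boxVolume d N * (massShift d bc β α N - L')))
        + ENNReal.ofReal (Real.exp (boxVolume d N * (massShift d bc β α N - L'))) :=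
        add_le_add h1 (hKN N hN)
    _ = ENNReal.ofReal ((c + 1) *
          Real.exp (boxVolume d N * (massShift d bc β α N - L'))) := by
        rw [ENNReal.ofReal_mul (by positivity), ENNReal.ofReal_add (by positivity) zero_le_one,
          ENNReal.ofReal_natCast, ENNReal.ofReal_one, add_mul, one_mul]
    _ ≤ _ := by
        refine ENNReal.ofReal_le_ofReal ((mul_le_mul_of_nonneg_right h2
          (Real.exp_pos _).le).trans_eq ?_)
        rw [← Real.exp_add]
        congr 1
        ring

/-! ### The lower bound -/

lemma log_factorial_le (n : ℕ) :
    Real.log n.factorial ≤ n * Real.log n - n + 1 + Real.log n := by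
  induction n with
  | zero => simp
  | succ n ih =>
    rcases n.eq_zero_or_pos with rfl | hn
    · simp
    have hn' : 0 < (n : ℝ) := by exact_mod_cast hn
    have h := Real.one_sub_inv_le_log_of_pos (show 0 < ((n : ℝ) + 1) / n by positivity)
    rw [Real.log_div (by positivity) hn'.ne'] at h
    have h2 := mul_le_mul_of_nonneg_left h (by positivity : 0 ≤ (n : ℝ) + 1)
    have h3 : ((n : ℝ) + 1) * (1 - (((n : ℝ) + 1) / n)⁻¹) = 1 := by
      field_simp
      ring
    rw [Nat.factorial_succ, Nat.cast_mul, Real.log_mul (by positivity) (by positivity)]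
    push_cast
    linarith

/-- The contribution of a single configuration `n`. -/
lemma le_pmfUnnormalised {d : ℕ} (hd : 1 ≤ d) (bc : BoundaryCondition) {β α : ℝ}
    (hβ : 0 < β) (a μ : ℝ) (hα : α ≤ 0) {N : ℕ} (hN : 1 ≤ N) {G : Set EllOne} (hG : IsOpen G)
    {n : ℕ+ → ℕ} {S : Finset ℕ+} (hn : ∀ k ∉ S, n k = 0) (hnG : empiricalCycleCount d N n ∈ G)
    (hpos : ∀ k ∈ S, 0 < bcCycleWeight d N bc β 0 k) :
    ENNReal.ofReal (Real.exp (-(boxVolume d N *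
      (β * (-(μ + α) * (∑ k ∈ S, (k : ℝ) * (n k / boxVolume d N))
        + a / 2 * (∑ k ∈ S, (k : ℝ) * (n k / boxVolume d N)) ^ 2)
        + ∑' k, bcCycleWeight d N bc β α k))
      - ∑ k ∈ S, (Real.log (n k).factorial
        - n k * Real.log (boxVolume d N * bcCycleWeight d N bc β 0 k))))
      ≤ pmfUnnormalised d bc β a μ α N G := by
  have hV := boxVolume_pos d hN
  have hfin : (Function.support n).Finite := S.finite_toSet.subset fun k hk => by
    by_contra h
    exact hk (hn k h)
  have hsum : ∑' k : ℕ+, (k : ℝ) * n k = ∑ k ∈ S, (k : ℝ) * n k :=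
    tsum_eq_sum fun k hk => by simp [hn k hk]
  have hdiv : (∑ k ∈ S, (k : ℝ) * n k) / boxVolume d N
      = ∑ k ∈ S, (k : ℝ) * (n k / boxVolume d N) := by
    rw [Finset.sum_div]
    simp_rw [mul_div_assoc]
  have hP := infinitePi_poissonMeasure_singleton_ge
    (summable_toNNReal_boxVolume_mul hd bc hβ hα hN) n S hn
  simp_rw [coe_toNNReal_boxVolume_mul d N bc hβ] at hP
  have hprod : ∏ k ∈ S, (boxVolume d N * bcCycleWeight d N bc β α k) ^ n k / (n k).factorial
      = Real.exp (∑ k ∈ S, (β * α * (k * n k) - (Real.log (n k).factorial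
        - n k * Real.log (boxVolume d N * bcCycleWeight d N bc β 0 k)))) := by
    rw [Real.exp_sum]
    refine Finset.prod_congr rfl fun k hk => ?_
    have hq := mul_pos hV (hpos k hk)
    rw [bcCycleWeight_eq_exp_mul d N bc β α, Real.exp_sub, Real.exp_sub,
      Real.exp_log (by positivity), Real.exp_nat_mul, Real.exp_log hq,
      show β * α * ((k : ℝ) * n k) = n k * (β * α * k) by ring, Real.exp_nat_mul]
    field_simp
    ring
  rw [Finset.sum_sub_distrib, ← Finset.mul_sum] at hprod
  rw [hprod, ← Real.exp_add, tsum_mul_left] at hP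
  rw [pmfUnnormalised_apply hd bc hβ a μ hα hN hG.measurableSet]
  refine le_trans ?_ (setLIntegral_le_lintegral {n} _)
  rw [lintegral_singleton, Set.indicator_of_mem hnG,
    pmfBoltzmann_empiricalCycleCount hN β a μ α hfin, hsum, hdiv]
  refine le_trans (le_of_eq ?_) (mul_le_mul_right hP _)
  rw [← ENNReal.ofReal_mul (Real.exp_pos _).le, ← Real.exp_add]
  congr 2
  ring

lemma pmfUnnormalised_univ_pos {d : ℕ} (hd : 1 ≤ d) (bc : BoundaryCondition) {β α : ℝ}
    (hβ : 0 < β) (a μ : ℝ) (hα : α ≤ 0) {N : ℕ} (hN : 1 ≤ N) :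
    0 < pmfUnnormalised d bc β a μ α N Set.univ :=
  (ENNReal.ofReal_pos.2 (Real.exp_pos _)).trans_le
    (le_pmfUnnormalised hd bc hβ a μ hα hN isOpen_univ (n := 0) (S := ∅) (by simp)
      (Set.mem_univ _) (by simp))

lemma pmfUnnormalised_univ_lt_top {d : ℕ} (hd : 1 ≤ d) (bc : BoundaryCondition) {β α a : ℝ}
    (hβ : 0 < β) (ha : 0 < a) (μ : ℝ) (hα : α ≤ 0) {N : ℕ} (hN : 1 ≤ N) :
    pmfUnnormalised d bc β a μ α N Set.univ < ∞ :=
  (pmfUnnormalised_le hd bc hβ a μ hα hN MeasurableSet.univ (b := 0) (t := 0)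
    (fun y _ => pmfHamiltonian_ge ha _ y) (fun y _ => by simp)
    (by simpa using summable_bcCycleWeight_zero hd bc hβ hN)).trans_lt ENNReal.ofReal_lt_top

lemma tendsto_floor_mul_boxVolume_div {d : ℕ} (hd : 1 ≤ d) {u : ℝ} (hu : 0 ≤ u) :
    Tendsto (fun N => (⌊u * boxVolume d N⌋₊ : ℝ) / boxVolume d N) atTop (𝓝 u) :=
  (tendsto_nat_floor_mul_div_atTop hu).comp (tendsto_boxVolume hd)

lemma tendsto_empiricalCycleCount_floor {d : ℕ} (hd : 1 ≤ d) {y : EllOne}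
    (hy : y ∈ ellOneNonneg) {S : Finset ℕ+} (hS : ∀ k ∉ S, y k = 0) :
    Tendsto (fun N => empiricalCycleCount d N fun k => ⌊y k * boxVolume d N⌋₊) atTop (𝓝 y) := by
  have hfin : ∀ N, (Function.support fun k => ⌊y k * boxVolume d N⌋₊).Finite := fun N =>
    S.finite_toSet.subset fun k hk => by
      by_contra h
      exact hk (by simp [hS k h])
  refine EllOne.tendsto_of_dominated (bound := fun k => if k ∈ S then 1 else 0)
    (summable_of_ne_finset_zero (s := S) fun k hk => if_neg hk) (fun k => ?_) ?_
  · simp_rw [empiricalCycleCount_apply d _ (hfin _)]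
    exact tendsto_floor_mul_boxVolume_div hd (hy k)
  · filter_upwards [(tendsto_boxVolume hd).eventually_ge_atTop 1] with N hN k
    rw [empiricalCycleCount_apply d N (hfin N)]
    split_ifs with hk
    · have hV : 0 < boxVolume d N := by linarith
      have h1 := Nat.floor_le (mul_nonneg (hy k) hV.le)
      have h2 := Nat.lt_floor_add_one (y k * boxVolume d N)
      rw [abs_le]
      constructor
      · rw [le_sub_iff_add_le, le_div_iff₀ hV]
        linarith
      · rw [sub_le_iff_le_add, div_le_iff₀ hV]
        linarith
    · simp [hS k hk]

/-- Stirling's formula for the Poisson weight of the value `⌊uV⌋`. -/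
lemma eventually_log_factorial_floor_lt {d : ℕ} (hd : 1 ≤ d) {u q : ℝ} (hu : 0 ≤ u) (hq : 0 < q)
    {w : ℕ → ℝ} (hw : Tendsto w atTop (𝓝 q)) {c : ℝ} (hc : u * Real.log (u / q) - u < c) :
    ∀ᶠ N in atTop, Real.log (⌊u * boxVolume d N⌋₊).factorial
      - ⌊u * boxVolume d N⌋₊ * Real.log (boxVolume d N * w N) < boxVolume d N * c := by
  have hv := tendsto_floor_mul_boxVolume_div hd hu
  have hV := tendsto_boxVolume hd
  set v : ℕ → ℝ := fun N => (⌊u * boxVolume d N⌋₊ : ℝ) / boxVolume d N with hvdef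
  have hlogV : Tendsto (fun N => Real.log (boxVolume d N) / boxVolume d N) atTop (𝓝 0) :=
    Real.isLittleO_log_id_atTop.tendsto_div_nhds_zero.comp hV
  have herr : Tendsto (fun N => (1 + (Real.log (boxVolume d N) + Real.log (u + 1)))
      / boxVolume d N) atTop (𝓝 0) := by
    have h := ((tendsto_const_nhds (x := 1 + Real.log (u + 1))).div_atTop hV).add hlogV
    rw [add_zero] at h
    refine h.congr fun N => ?_
    ring
  have hmain : Tendsto (fun N => v N * Real.log (v N) - v N - v N * Real.log (w N)
      + (1 + (Real.log (boxVolume d N) + Real.log (u + 1))) / boxVolume d N) atTop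
      (𝓝 (u * Real.log u - u - u * Real.log q + 0)) :=
    ((((Real.continuous_mul_log.tendsto u).comp hv).sub hv).sub
      (hv.mul (hw.log hq.ne'))).add herr
  have hlim : u * Real.log u - u - u * Real.log q + 0 < c := by
    rcases hu.eq_or_lt with rfl | hu
    · simpa using hc
    · rw [Real.log_div hu.ne' hq.ne'] at hc
      linarith
  filter_upwards [hmain.eventually_lt_const hlim, hV.eventually_ge_atTop 1,
    hw.eventually_const_lt hq] with N h1 hV1 hwN
  have hV0 : 0 < boxVolume d N := by linarith
  have hle := log_factorial_le ⌊u * boxVolume d N⌋₊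
  have h2 := mul_lt_mul_of_pos_left h1 hV0
  refine lt_of_le_of_lt ?_ h2
  have hn : (⌊u * boxVolume d N⌋₊ : ℝ) = boxVolume d N * v N := by
    rw [hvdef]; field_simp
  rw [mul_add, mul_div_cancel₀ _ hV0.ne']
  rcases Nat.eq_zero_or_pos ⌊u * boxVolume d N⌋₊ with h0 | h0
  · have hv0 : v N = 0 := by rw [hvdef]; simp [h0]
    rw [h0, hv0]
    have := Real.log_nonneg hV1
    have := Real.log_nonneg (show 1 ≤ u + 1 by linarith)
    simp
    linarith
  · have h0' : (1 : ℝ) ≤ ⌊u * boxVolume d N⌋₊ := by exact_mod_cast h0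
    have hvpos : 0 < v N := by rw [hvdef]; positivity
    have hlogn : Real.log ⌊u * boxVolume d N⌋₊
        ≤ Real.log (boxVolume d N) + Real.log (u + 1) := by
      rw [← Real.log_mul hV0.ne' (by linarith)]
      refine Real.log_le_log (by linarith) ((Nat.floor_le (by positivity)).trans ?_)
      linarith
    have hlogn' : Real.log ⌊u * boxVolume d N⌋₊ = Real.log (boxVolume d N) + Real.log (v N) := by
      rw [hn, Real.log_mul hV0.ne' hvpos.ne']
    rw [Real.log_mul hV0.ne' hwN.ne']
    have h3 : (⌊u * boxVolume d N⌋₊ : ℝ) * Real.log ⌊u * boxVolume d N⌋₊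
        = boxVolume d N * v N * (Real.log (boxVolume d N) + Real.log (v N)) := by
      rw [hlogn', ← hn]
    rw [h3] at hle
    rw [hn]
    rw [hn] at hle hlogn
    linarith

lemma eventually_le_pmfUnnormalised {d : ℕ} (hd : 1 ≤ d) (bc : BoundaryCondition)
    {β α a : ℝ} (hβ : 0 < β) (ha : 0 < a) (μ : ℝ) (hα : α ≤ 0) {G : Set EllOne}
    (hG : IsOpen G) {x : EllOne} (hx : x ∈ G) {L : ℝ}
    (hL : pmfFunctional d β a (μ + α) x < L) :
    ∀ᶠ N in atTop, ENNReal.ofReal (Real.exp (boxVolume d N * (massShift d bc β α N - L)))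
      ≤ pmfUnnormalised d bc β a μ α N G := by
  have hq := fun k => cycleWeight_pos d hβ 0 k
  obtain ⟨y, hyG, hy, S, hS, hlt⟩ :=
    exists_finite_support_of_pmfFunctional_lt hd hβ ha hG hx hL
  set E : ℝ → ℝ := fun D => β * (-(μ + α) * D + a / 2 * D ^ 2) with hE
  -- a margin `δ` for each of the coordinates and for the sum of the remaining terms
  obtain ⟨δ, hδ0, hδ⟩ : ∃ δ : ℝ, 0 < δ ∧ E (∑ k ∈ S, (k : ℝ) * y k)
      + ∑ k ∈ S, (y k * Real.log (y k / cycleWeight d β 0 k) - y k)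
      + ∑' k, cycleWeight d β 0 k + (S.card + 1) * δ < L := by
    refine ⟨(L - (E (∑ k ∈ S, (k : ℝ) * y k)
      + ∑ k ∈ S, (y k * Real.log (y k / cycleWeight d β 0 k) - y k)
      + ∑' k, cycleWeight d β 0 k)) / (2 * (S.card + 1)), ?_, ?_⟩
    · exact div_pos (sub_pos.2 hlt) (by positivity)
    · have : ∀ z : ℝ, ((S.card : ℝ) + 1) * (z / (2 * (S.card + 1))) = z / 2 := fun z => by
        field_simp
      rw [this]
      have h : E (∑ k ∈ S, (k : ℝ) * y k)
        + ∑ k ∈ S, (y k * Real.log (y k / cycleWeight d β 0 k) - y k)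
        + ∑' k, cycleWeight d β 0 k < L := hlt
      linarith
  have hcoord : ∀ᶠ N in atTop, ∀ k ∈ S, Real.log (⌊y k * boxVolume d N⌋₊).factorial
      - ⌊y k * boxVolume d N⌋₊ * Real.log (boxVolume d N * bcCycleWeight d N bc β 0 k)
      < boxVolume d N * (y k * Real.log (y k / cycleWeight d β 0 k) - y k + δ) := by
    rw [Filter.eventually_all_finset]
    exact fun k _ => eventually_log_factorial_floor_lt hd (hy k) (hq k)
      (tendsto_bcCycleWeight d bc hβ k) (by linarith)
  have hpos : ∀ᶠ N in atTop, ∀ k ∈ S, 0 < bcCycleWeight d N bc β 0 k := by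
    rw [Filter.eventually_all_finset]
    exact fun k _ => (tendsto_bcCycleWeight d bc hβ k).eventually_const_lt (hq k)
  have henergy : Tendsto (fun N => E (∑ k ∈ S, (k : ℝ) *
      (⌊y k * boxVolume d N⌋₊ / boxVolume d N)) + ∑' k, bcCycleWeight d N bc β 0 k) atTop
      (𝓝 (E (∑ k ∈ S, (k : ℝ) * y k) + ∑' k, cycleWeight d β 0 k)) := by
    refine Tendsto.add ?_ (tendsto_tsum_bcCycleWeight_zero hd bc hβ)
    have hEc : Continuous E := by rw [hE]; fun_prop
    exact (hEc.tendsto _).comp (tendsto_finsetSum S fun k _ =>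
      (tendsto_floor_mul_boxVolume_div hd (hy k)).const_mul _)
  filter_upwards [hcoord, hpos, henergy.eventually_lt_const (lt_add_of_pos_right _ hδ0),
    (tendsto_empiricalCycleCount_floor hd hy hS).eventually (hG.mem_nhds hyG),
    eventually_ge_atTop 1] with N h1 h2 h3 h4 hN
  have hV := boxVolume_pos d hN
  refine le_trans (ENNReal.ofReal_le_ofReal (Real.exp_le_exp.2 ?_))
    (le_pmfUnnormalised hd bc hβ a μ hα hN hG (S := S) (fun k hk => by simp [hS k hk]) h4 h2)
  have h5 := Finset.sum_le_sum fun k hk => (h1 k hk).le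
  rw [← Finset.mul_sum, Finset.sum_add_distrib, Finset.sum_const, nsmul_eq_mul] at h5
  have h6 := mul_lt_mul_of_pos_left h3 hV
  have h7 := mul_lt_mul_of_pos_left hδ hV
  simp only [hE] at h6 h7
  rw [massShift]
  linarith

/-! ### Normalisation -/

lemma isProbabilityMeasure_pmfMeasure {d : ℕ} (hd : 1 ≤ d) (bc : BoundaryCondition) {β α a : ℝ}
    (hβ : 0 < β) (ha : 0 < a) (μ : ℝ) (hα : α ≤ 0) {N : ℕ} (hN : 1 ≤ N) :
    IsProbabilityMeasure (pmfMeasure d bc β a μ α N) := by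
  constructor
  rw [pmfMeasure_eq_smul, Measure.smul_apply, smul_eq_mul, pmfPartition_eq]
  exact ENNReal.inv_mul_cancel (pmfUnnormalised_univ_pos hd bc hβ a μ hα hN).ne'
    (pmfUnnormalised_univ_lt_top hd bc hβ ha μ hα hN).ne

lemma inv_mul_log_ofReal_exp {V : ℝ} (hV : 0 < V) (c : ℝ) :
    ((V⁻¹ : ℝ) : EReal) * ENNReal.log (ENNReal.ofReal (Real.exp (V * c))) = (c : EReal) := by
  rw [ENNReal.log_ofReal_of_pos (Real.exp_pos _), Real.log_exp, ← EReal.coe_mul,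
    inv_mul_cancel_left₀ hV.ne']

lemma inv_mul_log_mono {V : ℝ} (hV : 0 < V) {x y : ℝ≥0∞} (h : x ≤ y) :
    ((V⁻¹ : ℝ) : EReal) * ENNReal.log x ≤ ((V⁻¹ : ℝ) : EReal) * ENNReal.log y :=
  mul_le_mul_of_nonneg_left (ENNReal.log_monotone h) (EReal.coe_nonneg.2 (inv_nonneg.2 hV.le))

lemma pmfRate_eq {d : ℕ} {β a μ α r : ℝ}
    (hr : ⨅ x, pmfFunctional d β a (μ + α) x = (r : EReal)) (x : EllOne) :
    pmfRate d β a μ α x = pmfFunctional d β a (μ + α) x - (r : EReal) := by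
  rw [← hr]
  rfl

lemma inv_ofReal_exp_mul_ofReal_exp (s t : ℝ) :
    (ENNReal.ofReal (Real.exp s))⁻¹ * ENNReal.ofReal (Real.exp t)
      = ENNReal.ofReal (Real.exp (t - s)) := by
  rw [← ENNReal.ofReal_inv_of_pos (Real.exp_pos s), ← Real.exp_neg,
    ← ENNReal.ofReal_mul (Real.exp_pos _).le, ← Real.exp_add]
  congr 2
  ring

lemma satisfiesLDP_pmfMeasure {d : ℕ} (hd : 1 ≤ d) (bc : BoundaryCondition) {β α a : ℝ}
    (hβ : 0 < β) (ha : 0 < a) (μ : ℝ) (hα : α ≤ 0) :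
    SatisfiesLDP (pmfMeasure d bc β a μ α) (boxVolume d) (pmfRate d β a μ α) := by
  obtain ⟨r, hr⟩ := exists_iInf_pmfFunctional_eq hd hβ ha (μ + α)
  have hrate := pmfRate_eq hr
  have hlt_iff : ∀ x (L : ℝ), pmfRate d β a μ α x < (L : EReal) ↔
      pmfFunctional d β a (μ + α) x < ((L + r : ℝ) : EReal) := fun x L => by
    rw [hrate, EReal.sub_lt_iff (.inl (EReal.coe_ne_bot r)) (.inl (EReal.coe_ne_top r)),
      EReal.coe_add]
  -- the partition function has exponential rate `r`
  have hZup : ∀ L : ℝ, L < r → ∀ᶠ N in atTop, pmfPartition d bc β a μ α N ≤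
      ENNReal.ofReal (Real.exp (boxVolume d N * (massShift d bc β α N - L))) := fun L hL => by
    simp_rw [pmfPartition_eq]
    refine eventually_pmfUnnormalised_le hd bc hβ ha μ hα isClosed_univ ?_
    simpa [hr] using hL
  have hZlow : ∀ L : ℝ, r < L → ∀ᶠ N in atTop,
      ENNReal.ofReal (Real.exp (boxVolume d N * (massShift d bc β α N - L)))
        ≤ pmfPartition d bc β a μ α N := fun L hL => by
    simp_rw [pmfPartition_eq]
    have h : ⨅ x, pmfFunctional d β a (μ + α) x < (L : EReal) := by
      rw [hr]; exact EReal.coe_lt_coe_iff.2 hL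
    obtain ⟨x, hx⟩ := iInf_lt_iff.1 h
    exact eventually_le_pmfUnnormalised hd bc hβ ha μ hα isOpen_univ (Set.mem_univ x) hx
  refine ⟨fun x => ?_, ?_, fun F hF => ?_, fun G hG => ?_⟩
  · rw [hrate, EReal.sub_nonneg (.inr (EReal.coe_ne_top r)) (.inr (EReal.coe_ne_bot r)), ← hr]
    exact iInf_le _ x
  · have h : pmfRate d β a μ α
        = fun x => pmfFunctional d β a (μ + α) x + ((-r : ℝ) : EReal) := by
      ext x
      rw [hrate, sub_eq_add_neg, EReal.coe_neg]
    rw [h]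
    exact (lowerSemicontinuous_pmfFunctional d hβ ha _).add' lowerSemicontinuous_const fun x =>
      EReal.continuousAt_add (.inr (EReal.coe_ne_bot _)) (.inr (EReal.coe_ne_top _))
  · by_contra hcon
    rw [not_le] at hcon
    obtain ⟨c, hc1, hc2⟩ := EReal.lt_iff_exists_real_btwn.1 hcon
    have hL : ((-c : ℝ) : EReal) < ⨅ x ∈ F, pmfRate d β a μ α x := by
      rw [EReal.coe_neg]; exact EReal.neg_lt_comm.1 hc1
    obtain ⟨L₁, h1, h2⟩ := EReal.lt_iff_exists_real_btwn.1 hL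
    rw [EReal.coe_lt_coe_iff] at h1
    obtain ⟨L₂, h3, h4⟩ := exists_between h1
    have hF' : ((L₂ + r : ℝ) : EReal) < ⨅ x ∈ F, pmfFunctional d β a (μ + α) x := by
      refine (EReal.coe_lt_coe_iff.2 (show L₂ + r < L₁ + r by linarith)).trans_le
        (le_iInf₂ fun x hx => ?_)
      rw [← not_lt, ← hlt_iff, not_lt]
      exact h2.le.trans (iInf₂_le x hx)
    refine hc2.not_ge (limsup_le_of_le (by isBoundedDefault) ?_)
    filter_upwards [eventually_pmfUnnormalised_le hd bc hβ ha μ hα hF hF',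
      hZlow (L₂ + r + c) (by linarith), eventually_ge_atTop 1] with N hM hZ hN
    have hV := boxVolume_pos d hN
    rw [← inv_mul_log_ofReal_exp hV c]
    refine inv_mul_log_mono hV ?_
    rw [pmfMeasure_eq_smul, Measure.smul_apply, smul_eq_mul]
    refine (mul_le_mul' (ENNReal.inv_le_inv.2 hZ) hM).trans_eq ?_
    rw [inv_ofReal_exp_mul_ofReal_exp]
    congr 2
    ring
  · by_contra hcon
    rw [not_le] at hcon
    obtain ⟨c, hc1, hc2⟩ := EReal.lt_iff_exists_real_btwn.1 hcon
    have hL : ⨅ x ∈ G, pmfRate d β a μ α x < ((-c : ℝ) : EReal) := by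
      rw [EReal.coe_neg]; exact EReal.lt_neg_comm.1 hc2
    simp only [iInf_lt_iff] at hL
    obtain ⟨x, hxG, hx⟩ := hL
    rw [hlt_iff] at hx
    obtain ⟨L₁, h1, h2⟩ := EReal.lt_iff_exists_real_btwn.1 hx
    rw [EReal.coe_lt_coe_iff] at h2
    refine hc1.not_ge (le_liminf_of_le (by isBoundedDefault) ?_)
    filter_upwards [eventually_le_pmfUnnormalised hd bc hβ ha μ hα hG hxG h1,
      hZup (L₁ + c) (by linarith), eventually_ge_atTop 1] with N hM hZ hN
    have hV := boxVolume_pos d hN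
    rw [← inv_mul_log_ofReal_exp hV c]
    refine inv_mul_log_mono hV ?_
    rw [pmfMeasure_eq_smul, Measure.smul_apply, smul_eq_mul]
    refine le_trans (le_of_eq ?_) (mul_le_mul' (ENNReal.inv_le_inv.2 hZ) hM)
    rw [inv_ofReal_exp_mul_ofReal_exp]
    congr 2
    ring

theorem theorem1p4 (d : ℕ) (hd : 1 ≤ d) (β : ℝ) (hβ : 0 < β) (a : ℝ) (ha : 0 < a)
    (α : ℝ) (hα : α ≤ 0) (μ : ℝ) (bc : BoundaryCondition) :
    (∀ N : ℕ, 1 ≤ N → IsProbabilityMeasure (pmfMeasure d bc β a μ α N)) ∧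
    SatisfiesLDP (pmfMeasure d bc β a μ α) (boxVolume d) (pmfRate d β a μ α) ∧
    (∀ (m : ℝ) (x : EllOne), x ∈ ellOneNonneg →
      pmfHamiltonianLsc a m x = pmfHamiltonian a m x
        - ((1 / (2 * a) : ℝ) : EReal) *
          (max ((m : EReal) - (a : EReal) * (density x : EReal)) 0) ^ 2 ∧
      pmfHamiltonianLsc a m x =
        if ((m / a : ℝ) : EReal) ≤ (density x : EReal) then meanFieldEnergy a m (density x)
        else ((-(m ^ 2 / (2 * a)) : ℝ) : EReal)) :=
  ⟨fun _ hN => isProbabilityMeasure_pmfMeasure hd bc hβ ha μ hα hN,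
    satisfiesLDP_pmfMeasure hd bc hβ ha μ hα,
    fun m _ hx => ⟨pmfHamiltonianLsc_eq_sub ha m hx, pmfHamiltonianLsc_eq_ite ha m hx⟩⟩
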